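/- An instance consists of $n\ge 0$ keys $k_1<k_2<\dots<k_n$ from a linearly ordered set $K$ of possible queries, a weight $\beta_b\ge 0$ (a real number) for each key $k_b$ ($1\le b\le n$), and a weight $\alpha_a\ge 0$ for each interval $(k_a,k_{a+1})$ ($0\le a\le n$), where $k_0=-\infty$ and $k_{n+1}=+\infty$; each of these intervals contains some element of $K$. A two-way-comparison search tree for the instance is a rooted binary tree in which every non-leaf node is a comparison $q=k_b$ or $q<k_b$ with some key $k_b$, one child for each outcome, and whose $2n+1$ leaves are associated one-to-one with the $n$ keys and the $n+1$ intervals, such that for every query $q\in K$ (key or not) the search for $q$ from the root ends at the leaf associated with $k_b$ if $q=k_b$, and at the leaf associated with $(k_a,k_{a+1})$ if $q$ is not a key and lies in that interval. The cost of the tree is the sum, over its leaves, of the depth of the leaf times the weight of the associated key or interval; a search tree for the instance is optimal if no search tree for the instance has smaller cost. **Corollary 1.** There is an algorithm that, given $n$ and the weights $\beta_1,\dots,\beta_n,\alpha_0,\dots,\alpha_n$ of an instance, computes in $O(n^4)$ time (for $n\ge1$; in constant time for $n=0$) an optimal two-way-comparison search tree for the instance (in linked form, keys and intervals being given by their indices)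 together with its cost. Here an algorithm is one fixed program, the same for all $n$ and all instances, for a random access machine that operates at unit cost on words, that is, natural numbers bounded by a fixed polynomial in $n$ (addition, truncated subtraction, multiplication, comparison, array access), and on real numbers (addition, subtraction, comparison, and storage in arrays addressed by words). -/

import Mathlib

noncomputable section

namespace TwoWay

/-! ### The problem -/

/-- An instance with `n` keys from a linearly ordered set `K` of possible queries.
Keys are indexed from `0`: `key b` is the `(b+1)`-st smallest key.  The interval with index
`a ∈ {0, …, n}` is bounded below by `key (a-1)` (by `-∞` if `a = 0`) and above by `key a`
(by `+∞` if `a = n`).  Every interval contains a possible query.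
`β b` is the weight of `key b`, and `α a` is the weight of the interval with index `a`. -/
structure Inst (K : Type*) [LinearOrder K] (n : ℕ) where
  key : Fin n → K
  key_strictMono : StrictMono key
  gap_nonempty : ∀ a : Fin (n + 1), ∃ q : K,
    (∀ b : Fin n, b.val + 1 = a.val → key b < q) ∧ (∀ b : Fin n, b.val = a.val → q < key b)
  β : Fin n → ℝ
  β_nonneg : ∀ b, 0 ≤ β b
  α : Fin (n + 1) → ℝ
  α_nonneg : ∀ a, 0 ≤ α a

/-- What a leaf can be associated with: a key or an interval between consecutive keys. -/
inductive Label (n : ℕ)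
  | key (b : Fin n)
  | gap (a : Fin (n + 1))

/-- The two comparison operators. -/
inductive Cmp
  | eq
  | lt

/-- Rooted binary trees with labelled leaves whose inner nodes are comparisons `q = k_b` or
`q < k_b`; the first subtree is for the positive outcome, the second for the negative one. -/
inductive Tree (n : ℕ)
  | leaf (l : Label n)
  | node (c : Cmp) (b : Fin n) (yes no : Tree n)

namespace Tree

/-- The labels of the leaves, with multiplicity. -/
def leaves {n : ℕ} : Tree n → List (Label n)
  | leaf l => [l]
  | node _ _ yes no => yes.leaves ++ no.leaves

end Tree

namespace Inst

variable {K : Type*} [LinearOrder K] {n : ℕ}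

/-- The set of queries that a label stands for. -/
def region (I : Inst K n) : Label n → Set K
  | .key b => {I.key b}
  | .gap a => {q | (∀ b : Fin n, b.val + 1 = a.val → I.key b < q) ∧
      (∀ b : Fin n, b.val = a.val → q < I.key b)}

/-- The label of the leaf at which the search for `q` ends. -/
def search (I : Inst K n) (q : K) : Tree n → Label n
  | .leaf l => l
  | .node .eq b yes no => if q = I.key b then I.search q yes else I.search q no
  | .node .lt b yes no => if q < I.key b then I.search q yes else I.search q no

/-- Two-way-comparison search trees for the instance: every key and every interval is
associated with exactly one leaf, and the search identifies every query correctly. -/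
def IsSearchTree (I : Inst K n) (T : Tree n) : Prop :=
  T.leaves.Nodup ∧ (∀ l : Label n, l ∈ T.leaves) ∧
    ∀ (l : Label n) (q : K), q ∈ I.region l → I.search q T = l

def weight (I : Inst K n) : Label n → ℝ
  | .key b => I.β b
  | .gap a => I.α a

/-- The weighted depth of the leaves when the root is at depth `d`. -/
def costFrom (I : Inst K n) (d : ℕ) : Tree n → ℝ
  | .leaf l => (d : ℝ) * I.weight l
  | .node _ _ yes no => I.costFrom (d + 1) yes + I.costFrom (d + 1) no

/-- The cost: the sum over the leaves of depth times weight. -/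
def cost (I : Inst K n) (T : Tree n) : ℝ := I.costFrom 0 T

def IsOptimal (I : Inst K n) (T : Tree n) : Prop :=
  I.IsSearchTree T ∧ ∀ T' : Tree n, I.IsSearchTree T' → I.cost T ≤ I.cost T'

end Inst

/-! ### The machine

A random access machine with words (natural numbers up to a bound `w`) and real numbers.
It has registers and arrays of both sorts; a program uses finitely many of them.  Arrays are
addressed by words.  On words it can add, subtract (truncated at `0`), multiply and compare; on
reals it can only add, subtract and compare.  Each elementary operation takes one step. -/

structure State where
  /-- word registers -/
  reg : ℕ → ℕ
  /-- word arrays: `arr A i` is the cell of index `i` of the array `A` -/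
  arr : ℕ → ℕ → ℕ
  /-- real registers -/
  rreg : ℕ → ℝ
  /-- real arrays -/
  rarr : ℕ → ℕ → ℝ

/-- Word expressions. -/
inductive NExp
  | lit (c : ℕ)
  | var (x : ℕ)
  | read (A : ℕ) (i : NExp)
  | add (e f : NExp)
  | sub (e f : NExp)
  | mul (e f : NExp)

namespace NExp

def val (s : State) : NExp → ℕ
  | lit c => c
  | var x => s.reg x
  | read A i => s.arr A (i.val s)
  | add e f => e.val s + f.val s
  | sub e f => e.val s - f.val s
  | mul e f => e.val s * f.val s

/-- No number above `w` arises in the evaluation (registers and array cells are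
controlled when they are written). -/
def Fits (w : ℕ) (s : State) : NExp → Prop
  | lit c => c ≤ w
  | var _ => True
  | read _ i => i.Fits w s
  | add e f => e.Fits w s ∧ f.Fits w s ∧ e.val s + f.val s ≤ w
  | sub e f => e.Fits w s ∧ f.Fits w s
  | mul e f => e.Fits w s ∧ f.Fits w s ∧ e.val s * f.val s ≤ w

/-- Number of steps of the evaluation. -/
def time : NExp → ℕ
  | lit _ => 1
  | var _ => 1
  | read _ i => i.time + 1
  | add e f => e.time + f.time + 1
  | sub e f => e.time + f.time + 1
  | mul e f => e.time + f.time + 1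

end NExp

/-- Real expressions. -/
inductive RExp
  | zero
  | var (x : ℕ)
  | read (A : ℕ) (i : NExp)
  | add (e f : RExp)
  | sub (e f : RExp)

namespace RExp

def val (s : State) : RExp → ℝ
  | zero => 0
  | var x => s.rreg x
  | read A i => s.rarr A (i.val s)
  | add e f => e.val s + f.val s
  | sub e f => e.val s - f.val s

def Fits (w : ℕ) (s : State) : RExp → Prop
  | zero => True
  | var _ => True
  | read _ i => i.Fits w s
  | add e f => e.Fits w s ∧ f.Fits w s
  | sub e f => e.Fits w s ∧ f.Fits w s

def time : RExp → ℕ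
  | zero => 1
  | var _ => 1
  | read _ i => i.time + 1
  | add e f => e.time + f.time + 1
  | sub e f => e.time + f.time + 1

end RExp

/-- Tests. -/
inductive Test
  | le (e f : NExp)
  | eq (e f : NExp)
  | rle (e f : RExp)
  | not (c : Test)
  | and (c d : Test)

namespace Test

def Holds (s : State) : Test → Prop
  | le e f => e.val s ≤ f.val s
  | eq e f => e.val s = f.val s
  | rle e f => e.val s ≤ f.val s
  | not c => ¬ c.Holds s
  | and c d => c.Holds s ∧ d.Holds s

def Fits (w : ℕ) (s : State) : Test → Prop
  | le e f => e.Fits w s ∧ f.Fits w s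
  | eq e f => e.Fits w s ∧ f.Fits w s
  | rle e f => e.Fits w s ∧ f.Fits w s
  | not c => c.Fits w s
  | and c d => c.Fits w s ∧ d.Fits w s

def time : Test → ℕ
  | le e f => e.time + f.time + 1
  | eq e f => e.time + f.time + 1
  | rle e f => e.time + f.time + 1
  | not c => c.time + 1
  | and c d => c.time + d.time + 1

end Test

/-- Programs. -/
inductive Prog
  | skip
  | assign (x : ℕ) (e : NExp)
  | store (A : ℕ) (i e : NExp)
  | rassign (x : ℕ) (e : RExp)
  | rstore (A : ℕ) (i : NExp) (e : RExp)
  | seq (P Q : Prog)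
  | ite (c : Test) (P Q : Prog)
  | loop (c : Test) (P : Prog)

namespace State

def setReg (s : State) (x v : ℕ) : State :=
  { s with reg := Function.update s.reg x v }

def setArr (s : State) (A i v : ℕ) : State :=
  { s with arr := Function.update s.arr A (Function.update (s.arr A) i v) }

def setRreg (s : State) (x : ℕ) (v : ℝ) : State :=
  { s with rreg := Function.update s.rreg x v }

def setRarr (s : State) (A i : ℕ) (v : ℝ) : State :=
  { s with rarr := Function.update s.rarr A (Function.update (s.rarr A) i v) }

end State

/-- `Exec w P s t s'`: with words bounded by `w`, the program `P` started in the state `s`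
halts after `t` steps in the state `s'`.  A program that produces a number above `w` is stuck. -/
inductive Exec (w : ℕ) : Prog → State → ℕ → State → Prop
  | skip (s : State) : Exec w .skip s 1 s
  | assign (s : State) (x : ℕ) (e : NExp) (he : e.Fits w s) :
      Exec w (.assign x e) s (e.time + 1) (s.setReg x (e.val s))
  | store (s : State) (A : ℕ) (i e : NExp) (hi : i.Fits w s) (he : e.Fits w s) :
      Exec w (.store A i e) s (i.time + e.time + 1) (s.setArr A (i.val s) (e.val s))
  | rassign (s : State) (x : ℕ) (e : RExp) (he : e.Fits w s) :
      Exec w (.rassign x e) s (e.time + 1) (s.setRreg x (e.val s))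
  | rstore (s : State) (A : ℕ) (i : NExp) (e : RExp) (hi : i.Fits w s) (he : e.Fits w s) :
      Exec w (.rstore A i e) s (i.time + e.time + 1) (s.setRarr A (i.val s) (e.val s))
  | seq (P Q : Prog) (s s₁ s₂ : State) (t₁ t₂ : ℕ)
      (hP : Exec w P s t₁ s₁) (hQ : Exec w Q s₁ t₂ s₂) :
      Exec w (.seq P Q) s (t₁ + t₂) s₂
  | ite_pos (c : Test) (P Q : Prog) (s s₁ : State) (t : ℕ)
      (hc : c.Fits w s) (h : c.Holds s) (hP : Exec w P s t s₁) :
      Exec w (.ite c P Q) s (c.time + t) s₁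
  | ite_neg (c : Test) (P Q : Prog) (s s₁ : State) (t : ℕ)
      (hc : c.Fits w s) (h : ¬ c.Holds s) (hQ : Exec w Q s t s₁) :
      Exec w (.ite c P Q) s (c.time + t) s₁
  | loop_done (c : Test) (P : Prog) (s : State)
      (hc : c.Fits w s) (h : ¬ c.Holds s) :
      Exec w (.loop c P) s c.time s
  | loop_step (c : Test) (P : Prog) (s s₁ s₂ : State) (t₁ t₂ : ℕ)
      (hc : c.Fits w s) (h : c.Holds s) (hP : Exec w P s t₁ s₁)
      (hL : Exec w (.loop c P) s₁ t₂ s₂) :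
      Exec w (.loop c P) s (c.time + t₁ + t₂) s₂

/-- The machine is deterministic. -/
theorem Exec.det {w : ℕ} {P : Prog} {s s₁ s₂ : State} {t t' : ℕ}
    (h : Exec w P s t s₁) (h' : Exec w P s t' s₂) :
    t = t' ∧ s₁ = s₂ := by
  induction h generalizing t' s₂ with
  | seq P Q s a b t₁ t₂ hP hQ ih1 ih2 =>
    cases h' with | seq _ _ _ _ _ _ _ h1 h2 =>
    obtain ⟨rfl, rfl⟩ := ih1 h1
    obtain ⟨rfl, rfl⟩ := ih2 h2
    simp
  | ite_pos c P Q s a t hc h hP ih =>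
    cases h' with
    | ite_pos _ _ _ _ _ _ _ _ h1 => obtain ⟨rfl, rfl⟩ := ih h1; simp
    | ite_neg _ _ _ _ _ _ _ h0 h1 => exact absurd h h0
  | ite_neg c P Q s a t hc h hP ih =>
    cases h' with
    | ite_neg _ _ _ _ _ _ _ _ h1 => obtain ⟨rfl, rfl⟩ := ih h1; simp
    | ite_pos _ _ _ _ _ _ _ h0 h1 => exact absurd h0 h
  | loop_done c P s hc h =>
    cases h' with
    | loop_done => simp
    | loop_step _ _ _ _ _ _ _ _ h0 => exact absurd h0 h
  | loop_step c P s a b t₁ t₂ hc h hP hL ih1 ih2 =>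
    cases h' with
    | loop_done _ _ _ _ h0 => exact absurd h h0
    | loop_step _ _ _ _ _ _ _ _ h0 h1 h2 =>
      obtain ⟨rfl, rfl⟩ := ih1 h1
      obtain ⟨rfl, rfl⟩ := ih2 h2
      simp
  | _ => cases h'; simp

/-! ### Input and output -/

/-- The initial state: `n` is in word register `0`, the weights of the keys are in the cells
`0, …, n-1` of real array `0`, those of the intervals in the cells `0, …, n` of real array `1`,
and everything else is `0`. -/
def Inst.input {K : Type*} [LinearOrder K] {n : ℕ} (I : Inst K n) : State where
  reg := fun x => if x = 0 then n else 0
  arr := fun _ _ => 0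
  rreg := fun _ => 0
  rarr := fun A i =>
    if A = 0 then (if h : i < n then I.β ⟨i, h⟩ else 0)
    else if A = 1 then (if h : i < n + 1 then I.α ⟨i, h⟩ else 0)
    else 0

/-- The word `p` points to a record for the root of `T` in a linked representation of `T`.
Word array `0` holds the type of a node (`0` key leaf, `1` interval leaf, `2` equality test,
`3` less-than test), array `1` the index of its key or interval, and arrays `2` and `3`
the pointers to the roots of its two subtrees. -/
def State.Represents {n : ℕ} (s : State) : ℕ → Tree n → Prop
  | p, .leaf (.key b) => s.arr 0 p = 0 ∧ s.arr 1 p = b.val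
  | p, .leaf (.gap a) => s.arr 0 p = 1 ∧ s.arr 1 p = a.val
  | p, .node .eq b yes no => s.arr 0 p = 2 ∧ s.arr 1 p = b.val ∧
      s.Represents (s.arr 2 p) yes ∧ s.Represents (s.arr 3 p) no
  | p, .node .lt b yes no => s.arr 0 p = 3 ∧ s.arr 1 p = b.val ∧
      s.Represents (s.arr 2 p) yes ∧ s.Represents (s.arr 3 p) no

end TwoWay

end

/-! The tests on a path from the root confine a query to a run of intervals `i, …, j` and remove the
keys whose equality tests failed. If arbitrary sets of keys could be missing, dynamic programming
would face exponentially many subproblems. The exchange argument (`Valid.exchange_separates`,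
`Valid.exchange`) prevents this: if `h` is a heaviest remaining key, every tree can be replaced, at
no greater cost, by one whose root is a less-than test or the equality test for `h`. So keys may be
removed in the order of decreasing weight, ties being broken in a fixed way, and the keys still
present are those among the `st` lightest that lie in the range. This leaves `O(n ^ 3)` subproblems
`(st, i, j)`, each decided by at most one equality test and at most `n` less-than tests.

`Inst.isSearchTree_iff` links this to the original problem: as each label has exactly one leaf, a
search tree contains no redundant test and is precisely a tree of the inductive kind `Valid`. All
valid trees for a subproblem have the same leaves, hence the same weight (`Valid.wt_eq`), so below a
given root test the two subtrees can be optimized separately (`split_cost`).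

The remainder verifies a concrete program. Keys become available from the lightest to the heaviest,
and every subproblem has a fixed record whose number exceeds those of all records it depends on.
Trees can therefore share subtrees through pointers, and writing a record leaves all trees at
smaller addresses intact (`Frame.records`). The four nested levels `cell_runs`, `row_runs`,
`stage_runs` and `Inst.main_runs` take time of order `n + 1` to the powers `1`, `2`, `3` and `4`. -/

noncomputable section

namespace TwoWay

variable {K : Type*} [LinearOrder K] {n : ℕ}

/-! ### Searching for a label -/

/-- Whether the queries of a label lie below the key with index `b`. -/
def Label.Below (b : Fin n) : Label n → Prop
  | .key e => e.val < b.val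
  | .gap a => a.val ≤ b.val

open Classical in
/-- The leaf at which the search for any query of the label `l` ends. -/
def Tree.find (l : Label n) : Tree n → Label n
  | .leaf l' => l'
  | .node .eq b yes no => if l = .key b then yes.find l else no.find l
  | .node .lt b yes no => if l.Below b then yes.find l else no.find l

theorem Inst.region_nonempty (I : Inst K n) (l : Label n) : (I.region l).Nonempty := by
  cases l with
  | key b => exact ⟨_, rfl⟩
  | gap a => exact I.gap_nonempty a

theorem Inst.region_lt_iff (I : Inst K n) {l : Label n} {q : K} (hq : q ∈ I.region l)
    (b : Fin n) : q < I.key b ↔ l.Below b := by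
  cases l with
  | key e =>
    obtain rfl : q = I.key e := hq
    exact I.key_strictMono.lt_iff_lt
  | gap a =>
    obtain ⟨h1, h2⟩ := hq
    constructor
    · intro h
      by_contra hba
      have hba : b.val < a.val := not_le.mp hba
      have ha : a.val - 1 < n := by omega
      have := h1 ⟨a.val - 1, ha⟩ (by simp; omega)
      have h3 : I.key b ≤ I.key ⟨a.val - 1, ha⟩ :=
        I.key_strictMono.monotone (Fin.le_def.2 (by simp; omega))
      exact absurd (h3.trans_lt this) h.not_gt
    · intro h
      have h : a.val ≤ b.val := h
      have ha : a.val < n := by omega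
      exact (h2 ⟨a.val, ha⟩ rfl).trans_le (I.key_strictMono.monotone (Fin.le_def.2 h))

theorem Inst.region_eq_iff (I : Inst K n) {l : Label n} {q : K} (hq : q ∈ I.region l)
    (b : Fin n) : q = I.key b ↔ l = .key b := by
  cases l with
  | key e =>
    obtain rfl : q = I.key e := hq
    rw [I.key_strictMono.injective.eq_iff, Label.key.injEq]
  | gap a =>
    simp only [reduceCtorEq, iff_false]
    rintro rfl
    have h := I.region_lt_iff hq b
    simp only [lt_irrefl, false_iff] at h
    have hb : b.val < a.val := not_le.mp h
    by_cases hb' : b.val + 1 = a.val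
    · exact lt_irrefl _ (hq.1 b hb')
    · have ha : a.val - 1 < n := by omega
      have := hq.1 ⟨a.val - 1, ha⟩ (by simp; omega)
      exact absurd (I.key_strictMono.lt_iff_lt.1 this) (by simp [Fin.lt_def]; omega)

/-- No key separates two queries of the same region, so the outcome of each test depends on the
label alone, and the order on `K` drops out of the problem. -/
theorem Inst.search_eq_find (I : Inst K n) {l : Label n} {q : K} (hq : q ∈ I.region l)
    (T : Tree n) : I.search q T = T.find l := by
  induction T with
  | leaf l' => rfl
  | node c b yes no ihy ihn =>
    cases c
    · simp only [Inst.search, Tree.find, ihy, ihn]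
      have h := I.region_eq_iff hq b
      split_ifs <;> tauto
    · simp only [Inst.search, Tree.find, ihy, ihn]
      have h := I.region_lt_iff hq b
      split_ifs <;> tauto

theorem Tree.find_mem_leaves (l : Label n) (T : Tree n) : T.find l ∈ T.leaves := by
  induction T with
  | leaf l' => simp [find, leaves]
  | node c b yes no ihy ihn =>
    cases c <;> simp only [find, leaves, List.mem_append] <;> split_ifs <;> tauto

theorem Tree.leaves_ne_nil (T : Tree n) : T.leaves ≠ [] := by
  cases T <;> simp [leaves]
  rename_i y no
  intro h
  cases y <;> simp [leaves] at h
  rename_i a b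
  exact absurd h.1 (leaves_ne_nil a)

theorem Tree.exists_mem_leaves (T : Tree n) : ∃ l, l ∈ T.leaves :=
  List.exists_mem_of_ne_nil _ T.leaves_ne_nil

/-! ### Trees for subproblems -/

/-- The key `e` borders on an interval with index between `i` and `j` from below, or lies between
two of them. -/
def InRange (i j : ℕ) (e : Fin n) : Prop := i ≤ e.val + 1 ∧ e.val + 1 ≤ j

/-- The labels of the subproblem that consists of the intervals `i, …, j` and the keys in `A`
that are in this range. -/
def Label.Mem (A : Finset (Fin n)) (i j : ℕ) : Label n → Prop
  | .key e => e ∈ A ∧ InRange i j e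
  | .gap a => i ≤ a.val ∧ a.val ≤ j

/-- Search trees for subproblems. -/
inductive Valid : Finset (Fin n) → ℕ → ℕ → Tree n → Prop
  | leaf {A : Finset (Fin n)} (a : Fin (n + 1)) (hA : ∀ e ∈ A, ¬ InRange a.val a.val e) :
      Valid A a.val a.val (.leaf (.gap a))
  | eq {A : Finset (Fin n)} {i j : ℕ} {e : Fin n} {T : Tree n} (he : e ∈ A)
      (hr : InRange i j e) (hT : Valid (A.erase e) i j T) :
      Valid A i j (.node .eq e (.leaf (.key e)) T)
  -- Key `b` fails the test and goes right together with interval `b + 1`. This is why `InRange`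
  -- admits the key at the lower end of interval `i` but not the one at the upper end of interval
  -- `j`.
  | lt {A : Finset (Fin n)} {i j : ℕ} {b : Fin n} {L R : Tree n} (hi : i ≤ b.val)
      (hj : b.val < j) (hL : Valid A i b.val L) (hR : Valid A (b.val + 1) j R) :
      Valid A i j (.node .lt b L R)

namespace Valid

variable {A A' : Finset (Fin n)} {i j : ℕ} {T T' : Tree n}

/-- Used to exchange `A` and `A.erase e` once a less-than test has put `e` on the other side. -/
theorem congr (h : Valid A i j T) (hA : ∀ e, InRange i j e → (e ∈ A ↔ e ∈ A')) :
    Valid A' i j T := by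
  induction h generalizing A' with
  | leaf a h0 => exact .leaf a fun e he hr => h0 e ((hA e hr).2 he) hr
  | eq he hr hT ih =>
    refine .eq ((hA _ hr).1 he) hr (ih fun f hf => ?_)
    simp [hA f hf]
  | lt hi hj hL hR ihL ihR =>
    refine .lt hi hj (ihL fun e he => hA e ?_) (ihR fun e he => hA e ?_) <;>
    · unfold InRange at *; omega

theorem of_eq {e : Fin n} {Y : Tree n} (h : Valid A i j (.node .eq e Y T)) :
    Valid (A.erase e) i j T := by
  cases h with | eq _ _ hT => exact hT

theorem of_lt {b : Fin n} {L R : Tree n} (h : Valid A i j (.node .lt b L R)) :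
    i ≤ b.val ∧ b.val < j ∧ Valid A i b.val L ∧ Valid A (b.val + 1) j R := by
  cases h with | lt hi hj hL hR => exact ⟨hi, hj, hL, hR⟩

theorem mem_leaves (h : Valid A i j T) (l : Label n) : l ∈ T.leaves ↔ l.Mem A i j := by
  induction h with
  | leaf a h0 =>
    cases l with
    | key e => simpa [Tree.leaves, Label.Mem] using fun he => h0 e he
    | gap a' => simp [Tree.leaves, Label.Mem, Fin.ext_iff]; omega
  | @eq A i j e T he hr hT ih =>
    cases l with
    | key f =>
      simp only [Tree.leaves, List.mem_append, ih, Label.Mem, Finset.mem_erase,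
        List.mem_singleton, Label.key.injEq]
      by_cases hf : f = e
      · subst hf; simp [he, hr]
      · simp [hf]
    | gap a => simp [Tree.leaves, ih, Label.Mem]
  | lt hi hj hL hR ihL ihR =>
    simp only [Tree.leaves, List.mem_append, ihL, ihR]
    cases l with
    | key e =>
      simp only [Label.Mem, InRange, ← and_or_left]
      refine and_congr_right fun _ => ?_
      omega
    | gap a => simp only [Label.Mem]; omega

theorem nodup (h : Valid A i j T) : T.leaves.Nodup := by
  induction h with
  | leaf a h0 => simp [Tree.leaves]
  | eq he hr hT ih =>
    simp [Tree.leaves, ih, hT.mem_leaves, Label.Mem]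
  | lt hi hj hL hR ihL ihR =>
    refine List.nodup_append.2 ⟨ihL, ihR, ?_⟩
    rintro l hl _ hl' rfl
    rw [hL.mem_leaves] at hl
    rw [hR.mem_leaves] at hl'
    cases l <;> simp only [Label.Mem, InRange] at hl hl' <;> omega

theorem find_eq (h : Valid A i j T) {l : Label n} (hl : l.Mem A i j) : T.find l = l := by
  induction h with
  | leaf a h0 =>
    cases l with
    | key e => exact absurd hl.2 (h0 e hl.1)
    | gap a' =>
      simp only [Label.Mem] at hl
      simp only [Tree.find, Label.gap.injEq, Fin.ext_iff]; omega
  | @eq A i j e T he hr hT ih =>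
    simp only [Tree.find]
    split_ifs with h
    · exact h.symm
    · refine ih ?_
      cases l with
      | key f => exact ⟨Finset.mem_erase.2 ⟨fun hf => h (by rw [hf]), hl.1⟩, hl.2⟩
      | gap a => exact hl
  | lt hi hj hL hR ihL ihR =>
    simp only [Tree.find]
    split_ifs with h
    · apply ihL
      cases l <;> simp only [Label.Mem, InRange, Label.Below] at * <;> grind
    · apply ihR
      cases l <;> simp only [Label.Mem, InRange, Label.Below] at * <;> grind

theorem leaves_perm (h : Valid A i j T) (h' : Valid A i j T') : T.leaves.Perm T'.leaves :=
  (List.perm_ext_iff_of_nodup h.nodup h'.nodup).2 fun l => by rw [h.mem_leaves, h'.mem_leaves]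

/-- One leaf per label forbids redundant tests. At an equality test every other label must be found
on the negative side, so only the tested key is left for the positive one. At a less-than test both
subtrees have leaves, which forces `i ≤ b < j`. -/
theorem of_find {i j : ℕ} (hij : i ≤ j) (hj : j ≤ n) (hd : T.leaves.Nodup)
    (hm : ∀ l, l ∈ T.leaves ↔ l.Mem A i j) (hf : ∀ l : Label n, l.Mem A i j → T.find l = l) :
    Valid A i j T := by
  induction T generalizing A i j with
  | leaf l =>
    have h1 : Label.gap ⟨i, by omega⟩ = l := by
      simpa [Tree.leaves, Label.Mem, hij] using hm (.gap ⟨i, by omega⟩)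
    have h2 : Label.gap ⟨j, by omega⟩ = l := by
      simpa [Tree.leaves, Label.Mem, hij] using hm (.gap ⟨j, by omega⟩)
    subst h1
    obtain rfl : j = i := by simpa using h2
    refine .leaf (A := A) ⟨j, by omega⟩ fun e he hr => ?_
    simpa [Tree.leaves] using (hm (.key e)).2 ⟨he, hr⟩
  | node c b Y N ihY ihN =>
    simp only [Tree.leaves, List.mem_append] at hm
    obtain ⟨hdY, hdN, hdYN⟩ := List.nodup_append.1 hd
    cases c with
    | eq =>
      simp only [Tree.find] at hf
      have hN : ∀ l : Label n, l.Mem A i j → l ≠ .key b → l ∈ N.leaves := fun l hl hlb => by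
        have := hf l hl
        rw [if_neg hlb] at this
        exact this ▸ N.find_mem_leaves l
      have hY : ∀ l ∈ Y.leaves, l = .key b := fun l hl => by
        by_contra hlb
        exact hdYN l hl l (hN l ((hm l).1 (.inl hl)) hlb) rfl
      have hb : (Label.key b).Mem A i j := by
        obtain ⟨l, hl⟩ := Y.exists_mem_leaves
        exact hY l hl ▸ (hm l).1 (.inl hl)
      have hYb : Y = .leaf (.key b) := by
        cases Y with
        | leaf l => rw [hY l (by simp [Tree.leaves])]
        -- An inner node would have two leaves with the same label `key b`.
        | node c' b' Y' N' =>
          obtain ⟨l, hl⟩ := Y'.exists_mem_leaves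
          obtain ⟨l', hl'⟩ := N'.exists_mem_leaves
          refine absurd ?_ ((List.nodup_append.1 hdY).2.2 l hl l' hl')
          rw [hY l (by simp [Tree.leaves, hl]), hY l' (by simp [Tree.leaves, hl'])]
      subst hYb
      have hMem : ∀ l : Label n, l.Mem (A.erase b) i j ↔ l.Mem A i j ∧ l ≠ .key b := fun l => by
        cases l <;> simp [Label.Mem]; tauto
      refine .eq hb.1 hb.2 (ihN hij hj hdN (fun l => ?_) fun l hl => ?_)
      · rw [hMem]
        refine ⟨fun hl => ⟨(hm l).1 (.inr hl), fun h => ?_⟩, fun hl => hN l hl.1 hl.2⟩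
        exact hdYN l (by simp [Tree.leaves, h]) l hl rfl
      · rw [hMem] at hl
        have := hf l hl.1
        rwa [if_neg hl.2] at this
    | lt =>
      simp only [Tree.find] at hf
      have hY' : ∀ l : Label n, l.Mem A i j → l.Below b → Y.find l = l := fun l hl hlb => by
        simpa [hlb] using hf l hl
      have hN' : ∀ l : Label n, l.Mem A i j → ¬ l.Below b → N.find l = l := fun l hl hlb => by
        simpa [hlb] using hf l hl
      have hY : ∀ l : Label n, l ∈ Y.leaves ↔ l.Mem A i j ∧ l.Below b := fun l => by
        refine ⟨fun hl => ⟨(hm l).1 (.inl hl), ?_⟩, fun hl => hY' l hl.1 hl.2 ▸ Y.find_mem_leaves l⟩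
        by_contra hlb
        exact hdYN l hl l (hN' l ((hm l).1 (.inl hl)) hlb ▸ N.find_mem_leaves l) rfl
      have hN : ∀ l : Label n, l ∈ N.leaves ↔ l.Mem A i j ∧ ¬ l.Below b := fun l => by
        refine ⟨fun hl => ⟨(hm l).1 (.inr hl), fun hlb => ?_⟩,
          fun hl => hN' l hl.1 hl.2 ▸ N.find_mem_leaves l⟩
        exact hdYN l (hY' l ((hm l).1 (.inr hl)) hlb ▸ Y.find_mem_leaves l) l hl rfl
      have hib : i ≤ b.val := by
        obtain ⟨l, hl⟩ := Y.exists_mem_leaves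
        rw [hY] at hl
        cases l <;> simp only [Label.Mem, InRange, Label.Below] at hl <;> omega
      have hbj : b.val < j := by
        obtain ⟨l, hl⟩ := N.exists_mem_leaves
        rw [hN] at hl
        cases l <;> simp only [Label.Mem, InRange, Label.Below] at hl <;> omega
      have hMY : ∀ l : Label n, l.Mem A i b.val ↔ l.Mem A i j ∧ l.Below b := fun l => by
        cases l <;> simp only [Label.Mem, InRange, Label.Below, and_assoc]
        · refine and_congr_right fun _ => ?_
          omega
        · omega
      have hMN : ∀ l : Label n, l.Mem A (b.val + 1) j ↔ l.Mem A i j ∧ ¬ l.Below b := fun l => by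
        cases l <;> simp only [Label.Mem, InRange, Label.Below, and_assoc]
        · refine and_congr_right fun _ => ?_
          omega
        · omega
      refine .lt hib hbj (ihY hib (by omega) hdY (fun l => by rw [hY, hMY]) fun l hl => ?_)
        (ihN hbj hj hdN (fun l => by rw [hN, hMN]) fun l hl => ?_)
      · rw [hMY] at hl; exact hY' l hl.1 hl.2
      · rw [hMN] at hl; exact hN' l hl.1 hl.2

end Valid

theorem Inst.isSearchTree_iff (I : Inst K n) (T : Tree n) :
    I.IsSearchTree T ↔ Valid Finset.univ 0 n T := by
  have hmem : ∀ l : Label n, l.Mem Finset.univ 0 n := fun l => by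
    cases l <;> simp only [Label.Mem, InRange, Finset.mem_univ, true_and] <;> omega
  constructor
  · rintro ⟨hd, hm, hs⟩
    refine Valid.of_find (Nat.zero_le _) le_rfl hd (fun l => iff_of_true (hm l) (hmem l))
      fun l _ => ?_
    -- Correctness is known for actual queries only, so each label needs one; `gap_nonempty` enters
    -- here.
    obtain ⟨q, hq⟩ := I.region_nonempty l
    rw [← I.search_eq_find hq, hs l q hq]
  · intro h
    exact ⟨h.nodup, fun l => (h.mem_leaves l).2 (hmem l), fun l q hq => by
      rw [I.search_eq_find hq, h.find_eq (hmem l)]⟩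

/-! ### Weight and cost -/

/-- The total weight of the leaves. -/
def Inst.wt (I : Inst K n) : Tree n → ℝ
  | .leaf l => I.weight l
  | .node _ _ yes no => I.wt yes + I.wt no

theorem Inst.weight_nonneg (I : Inst K n) (l : Label n) : 0 ≤ I.weight l := by
  cases l
  · exact I.β_nonneg _
  · exact I.α_nonneg _

theorem Inst.wt_nonneg (I : Inst K n) (T : Tree n) : 0 ≤ I.wt T := by
  induction T with
  | leaf l => exact I.weight_nonneg l
  | node c b Y N ihY ihN => exact add_nonneg ihY ihN

theorem Inst.wt_eq_sum (I : Inst K n) (T : Tree n) : I.wt T = (T.leaves.map I.weight).sum := by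
  induction T with
  | leaf l => simp [wt, Tree.leaves]
  | node c b Y N ihY ihN => simp [wt, Tree.leaves, ihY, ihN]

theorem Inst.weight_le_wt (I : Inst K n) {T : Tree n} {l : Label n} (h : l ∈ T.leaves) :
    I.weight l ≤ I.wt T := by
  rw [I.wt_eq_sum]
  refine List.single_le_sum ?_ _ (List.mem_map_of_mem h)
  simp only [List.mem_map]
  rintro _ ⟨l, -, rfl⟩
  exact I.weight_nonneg l

theorem Inst.costFrom_eq (I : Inst K n) (d : ℕ) (T : Tree n) :
    I.costFrom d T = d * I.wt T + I.cost T := by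
  unfold cost
  induction T generalizing d with
  | leaf l => simp [costFrom, wt]
  | node c b Y N ihY ihN =>
    simp only [costFrom, wt]
    rw [ihY (d + 1), ihN (d + 1), ihY (0 + 1), ihN (0 + 1)]
    push_cast; ring

theorem Inst.cost_leaf (I : Inst K n) (l : Label n) : I.cost (.leaf l) = 0 := by
  simp [cost, costFrom]

theorem Inst.cost_node (I : Inst K n) (c : Cmp) (b : Fin n) (Y N : Tree n) :
    I.cost (.node c b Y N) = I.wt Y + I.wt N + I.cost Y + I.cost N := by
  rw [cost, costFrom, I.costFrom_eq, I.costFrom_eq]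
  push_cast; ring

theorem Inst.cost_nonneg (I : Inst K n) (T : Tree n) : 0 ≤ I.cost T := by
  induction T with
  | leaf l => rw [cost_leaf]
  | node c b Y N ihY ihN =>
    rw [cost_node]
    have := I.wt_nonneg Y
    have := I.wt_nonneg N
    positivity

theorem Valid.wt_eq (I : Inst K n) {A : Finset (Fin n)} {i j : ℕ} {T T' : Tree n}
    (h : Valid A i j T) (h' : Valid A i j T') : I.wt T = I.wt T' := by
  rw [I.wt_eq_sum, I.wt_eq_sum]
  exact ((h.leaves_perm h').map _).sum_eq

theorem Valid.le_wt (I : Inst K n) {A : Finset (Fin n)} {i j : ℕ} {T : Tree n}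
    (h : Valid A i j T) {e : Fin n} (he : e ∈ A) (hr : InRange i j e) : I.β e ≤ I.wt T :=
  I.weight_le_wt (l := .key e) ((h.mem_leaves _).2 ⟨he, hr⟩)

/-! ### The exchange argument -/

/-- Of the keys `e` and `f`, exactly one is below the key `d`. -/
def Separates (d e f : Fin n) : Prop :=
  (e.val < d.val ∧ d.val ≤ f.val) ∨ (f.val < d.val ∧ d.val ≤ e.val)

/-- Suppose the root of a tree is an equality test, and `h` is a key of maximum weight.  Then some
tree that costs no more has at its root the equality test for `h` or a less-than test that
separates `h` from the key originally tested. -/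
theorem Valid.exchange_separates (I : Inst K n) {A : Finset (Fin n)} {i j : ℕ} {e h : Fin n}
    {T : Tree n}
    (hT : Valid A i j (.node .eq e (.leaf (.key e)) T)) (hA : h ∈ A) (hr : InRange i j h)
    (hmax : ∀ f ∈ A, InRange i j f → I.β f ≤ I.β h) (hne : e ≠ h) :
    ∃ T', Valid A i j T' ∧ I.cost T' ≤ I.cost (.node .eq e (.leaf (.key e)) T) ∧
      ((∃ U, T' = .node .eq h (.leaf (.key h)) U) ∨
        ∃ d L R, T' = .node .lt d L R ∧ Separates d e h) := by
  -- The induction is on the number of leaves because it is applied inside the replacement `S` of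
  -- `T`, which has as many leaves but need not be related to `T` in structure.
  obtain ⟨N, hN⟩ : ∃ N, T.leaves.length = N := ⟨_, rfl⟩
  induction N using Nat.strong_induction_on generalizing A i j e T with
  | _ N ih =>
  cases hT with | eq he her hT =>
  have hhe : h ∈ A.erase e := Finset.mem_erase.2 ⟨hne.symm, hA⟩
  have hbe := hmax e he her
  -- it suffices to treat subtrees with a suitable root
  obtain ⟨S, hS, hcost, hroot⟩ : ∃ S, Valid (A.erase e) i j S ∧ I.cost S ≤ I.cost T ∧
      ((∃ U, S = .node .eq h (.leaf (.key h)) U) ∨ ∃ d L R, S = .node .lt d L R) := by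
    cases hT with
    | leaf a h0 => exact absurd hr (h0 h hhe)
    | @eq _ _ _ f U hf hfr hU =>
      by_cases hfh : f = h
      · subst hfh
        exact ⟨_, .eq hf hfr hU, le_rfl, .inl ⟨_, rfl⟩⟩
      · obtain ⟨S, h1, h2, h3⟩ := ih _ (by simp [← hN, Tree.leaves]) (.eq hf hfr hU) hhe hr
          (fun g hg => hmax g (Finset.mem_of_mem_erase hg)) hfh rfl
        -- The separation obtained here concerns `f` and `h`; it says nothing about `e` and is
        -- dropped.
        exact ⟨S, h1, h2, h3.imp_right fun ⟨d, L, R, h, _⟩ => ⟨d, L, R, h⟩⟩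
    | lt hi hj hL hR => exact ⟨_, .lt hi hj hL hR, le_rfl, .inr ⟨_, _, _, rfl⟩⟩
  have hlen := (hT.leaves_perm hS).length_eq
  have hwt := hT.wt_eq I hS
  rw [hlen] at hN
  rcases hroot with ⟨U, rfl⟩ | ⟨c, L, R, rfl⟩
  · have hU := hS.of_eq
    -- Swapping two consecutive equality tests lifts `h` and lowers `e` by one level, a change of `β
    -- e - β h ≤ 0`.
    refine ⟨.node .eq h (.leaf (.key h)) (.node .eq e (.leaf (.key e)) U),
      .eq hA hr (.eq (Finset.mem_erase.2 ⟨hne, he⟩) her ?_), ?_, .inl ⟨_, rfl⟩⟩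
    · rwa [Finset.erase_right_comm]
    · simp only [I.cost_node, I.cost_leaf, Inst.wt, Inst.weight] at *
      linarith
  obtain ⟨hic, hcj, hL, hR⟩ := hS.of_lt
  have hNe : (Tree.leaves L).length < N ∧ (Tree.leaves R).length < N := by
    have h1 := List.length_pos_of_ne_nil L.leaves_ne_nil
    have h2 := List.length_pos_of_ne_nil R.leaves_ne_nil
    simp [Tree.leaves] at hN
    omega
  simp only [Inst.wt] at hwt
  simp only [I.cost_node] at hcost
  simp only [InRange] at hr her
  have hwL := I.wt_nonneg L
  have hwR := I.wt_nonneg R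
  rcases lt_or_ge e.val c.val with hec | hec <;> rcases lt_or_ge h.val c.val with hhc | hhc
  · -- both keys below `c`
    have hRA : Valid A (c.val + 1) j R := hR.congr fun f hf => by
      have : f ≠ e := by rintro rfl; simp only [InRange] at hf; omega
      simp [this]
    -- The test for `e` is pushed below `c`, the induction hypothesis is applied there, and the new
    -- root is then lifted above `c`.
    obtain ⟨S, hS, hc, hroot⟩ := ih _ hNe.1 (.eq (T := L) he ⟨her.1, hec⟩ hL) hA ⟨hr.1, hhc⟩
      (fun f hf hfr => hmax f hf ⟨hfr.1, by have := hfr.2; omega⟩) hne rfl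
    have hw := (Valid.eq (T := L) he ⟨her.1, hec⟩ hL).wt_eq I hS
    rcases hroot with ⟨U, rfl⟩ | ⟨d, L', R', rfl, hd⟩
    · have hU := hS.of_eq
      -- The cost bound reduces to `wt U ≤ wt L`. This is `β e ≤ β h`, because `β e + wt L = β h +
      -- wt U`.
      refine ⟨.node .eq h (.leaf (.key h)) (.node .lt c U R), .eq hA hr (.lt hic hcj hU ?_), ?_,
        .inl ⟨_, rfl⟩⟩
      · refine hRA.congr fun f hf => ?_
        have : f ≠ h := by rintro rfl; simp only [InRange] at hf; omega
        simp [this]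
      · simp only [I.cost_node, I.cost_leaf, Inst.wt, Inst.weight] at *
        linarith
    · obtain ⟨hid, hdc, hL', hR'⟩ := hS.of_lt
      refine ⟨.node .lt d L' (.node .lt c R' R), .lt hid (by omega) hL'
          (.lt (by omega) hcj hR' hRA),
        ?_, .inr ⟨_, _, _, rfl, hd⟩⟩
      -- The rotation requires `wt R' ≤ wt L`, that is, `β e ≤ wt L'`. As `d` separates `e` from
      -- `h`, one of them lies in `L'`, and each weighs at least `β e`.
      have : I.β e ≤ I.wt L' := by
        rcases hd with hd | hd
        · exact hL'.le_wt I he ⟨her.1, hd.1⟩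
        · exact hbe.trans (hL'.le_wt I hA ⟨hr.1, hd.1⟩)
      simp only [I.cost_node, I.cost_leaf, Inst.wt, Inst.weight] at *
      linarith
  -- The test for `e` moves into the side of `e`. Then `e` drops by one level, while the other side
  -- rises by one and contains `h`, so that it weighs at least `β e`.
  · refine ⟨.node .lt c (.node .eq e (.leaf (.key e)) L) R,
      .lt hic hcj (.eq he ⟨her.1, hec⟩ hL) (hR.congr fun f hf => ?_), ?_,
      .inr ⟨_, _, _, rfl, .inl ⟨hec, hhc⟩⟩⟩
    · have : f ≠ e := by rintro rfl; simp only [InRange] at hf; omega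
      simp [this]
    · have := hbe.trans (hR.le_wt I hhe ⟨by omega, hr.2⟩)
      simp only [I.cost_node, I.cost_leaf, Inst.wt, Inst.weight] at *
      linarith
  · refine ⟨.node .lt c L (.node .eq e (.leaf (.key e)) R),
      .lt hic hcj (hL.congr fun f hf => ?_) (.eq he ⟨by omega, her.2⟩ hR), ?_,
      .inr ⟨_, _, _, rfl, .inr ⟨hhc, hec⟩⟩⟩
    · have : f ≠ e := by rintro rfl; simp only [InRange] at hf; omega
      simp [this]
    · have := hbe.trans (hL.le_wt I hhe ⟨hr.1, hhc⟩)
      simp only [I.cost_node, I.cost_leaf, Inst.wt, Inst.weight] at *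
      linarith
  -- Neither key is below `c`: the mirror image of the first case.
  · have hLA : Valid A i c.val L := hL.congr fun f hf => by
      have : f ≠ e := by rintro rfl; simp only [InRange] at hf; omega
      simp [this]
    have her' : InRange (c.val + 1) j e := ⟨by omega, her.2⟩
    have hr' : InRange (c.val + 1) j h := ⟨by omega, hr.2⟩
    obtain ⟨S, hS, hc, hroot⟩ := ih _ hNe.2 (.eq (T := R) he her' hR) hA hr'
      (fun f hf hfr => hmax f hf ⟨by have := hfr.1; omega, hfr.2⟩) hne rfl
    have hw := (Valid.eq (T := R) he her' hR).wt_eq I hS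
    rcases hroot with ⟨U, rfl⟩ | ⟨d, L', R', rfl, hd⟩
    · have hU := hS.of_eq
      refine ⟨.node .eq h (.leaf (.key h)) (.node .lt c L U), .eq hA hr (.lt hic hcj ?_ hU), ?_,
        .inl ⟨_, rfl⟩⟩
      · refine hLA.congr fun f hf => ?_
        have : f ≠ h := by rintro rfl; simp only [InRange] at hf; omega
        simp [this]
      · simp only [I.cost_node, I.cost_leaf, Inst.wt, Inst.weight] at *
        linarith
    · obtain ⟨hid, hdc, hL', hR'⟩ := hS.of_lt
      refine ⟨.node .lt d (.node .lt c L L') R', .lt (by omega) hdc (.lt hic (by omega) hLA hL')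
          hR',
        ?_, .inr ⟨_, _, _, rfl, hd⟩⟩
      have : I.β e ≤ I.wt R' := by
        rcases hd with hd | hd
        · exact hbe.trans (hR'.le_wt I hA ⟨by omega, hr.2⟩)
        · exact hR'.le_wt I he ⟨by omega, her.2⟩
      simp only [I.cost_node, I.cost_leaf, Inst.wt, Inst.weight] at *
      linarith

/-- If `h` is a key of maximum weight, then every tree can be replaced by one that costs no more
and has the equality test for `h` or a less-than test at its root. -/
theorem Valid.exchange (I : Inst K n) {A : Finset (Fin n)} {i j : ℕ} {h : Fin n} {T : Tree n}
    (hT : Valid A i j T) (hA : h ∈ A) (hr : InRange i j h)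
    (hmax : ∀ f ∈ A, InRange i j f → I.β f ≤ I.β h) :
    (∃ U, Valid (A.erase h) i j U ∧
      I.cost (.node .eq h (.leaf (.key h)) U) ≤ I.cost T) ∨
    ∃ d L R, Valid A i j (.node .lt d L R) ∧ I.cost (.node .lt d L R) ≤ I.cost T := by
  cases hT with
  | leaf a h0 => exact absurd hr (h0 h hA)
  | @eq _ _ _ e U he her hU =>
    by_cases heh : e = h
    · subst heh
      exact .inl ⟨U, hU, le_rfl⟩
    · obtain ⟨T', hT', hc, ⟨U', rfl⟩ | ⟨d, L, R, rfl, -⟩⟩ :=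
        (Valid.eq he her hU).exchange_separates I hA hr hmax heh
      · exact .inl ⟨U', hT'.of_eq, hc⟩
      · exact .inr ⟨d, L, R, hT', hc⟩
  | lt hi hj hL hR => exact .inr ⟨_, _, _, .lt hi hj hL hR, le_rfl⟩

/-! ### Reasoning about programs -/

/-- Started in the state `s`, the program halts within `t` steps in a state satisfying `Q`. -/
def Runs (w : ℕ) (P : Prog) (s : State) (t : ℕ) (Q : State → Prop) : Prop :=
  ∃ t' s', Exec w P s t' s' ∧ t' ≤ t ∧ Q s'

namespace Runs

variable {w t t₁ t₂ : ℕ} {P P' : Prog} {s : State} {Q R : State → Prop}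

theorem mono (h : Runs w P s t₁ Q) (ht : t₁ ≤ t) (hQ : ∀ s', Q s' → R s') : Runs w P s t R := by
  obtain ⟨t', s', he, h1, h2⟩ := h
  exact ⟨t', s', he, h1.trans ht, hQ s' h2⟩

theorem seq (h : Runs w P s t₁ Q) (h' : ∀ s', Q s' → Runs w P' s' t₂ R) :
    Runs w (.seq P P') s (t₁ + t₂) R := by
  obtain ⟨a, s', he, h1, h2⟩ := h
  obtain ⟨b, s'', he', h1', h2'⟩ := h' s' h2
  exact ⟨_, s'', .seq _ _ _ _ _ _ _ he he', by omega, h2'⟩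

/-- The rule for a loop that is passed `m - k` times, each pass taking at most `t` steps. -/
theorem loop {c : Test} (J : ℕ → State → Prop) {m : ℕ}
    (hfits : ∀ k s, J k s → c.Fits w s) (htest : ∀ k s, J k s → (c.Holds s ↔ k < m))
    (hbody : ∀ k s, k < m → J k s → Runs w P s t (J (k + 1)))
    {k : ℕ} (hk : k ≤ m) (hs : J k s) :
    Runs w (.loop c P) s ((m - k) * (t + c.time) + c.time) (J m) := by
  obtain ⟨d, hd⟩ : ∃ d, m - k = d := ⟨_, rfl⟩
  induction d generalizing k s with
  | zero =>
    obtain rfl : k = m := by omega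
    exact ⟨_, s, .loop_done _ _ _ (hfits k s hs) (by rw [htest k s hs]; omega), by simp, hs⟩
  | succ d ih =>
    have hkm : k < m := by omega
    obtain ⟨t₁, s₁, he, h1, h2⟩ := hbody k s hkm hs
    obtain ⟨t₂, s₂, he', h1', h2'⟩ := ih hkm h2 (by omega)
    refine ⟨_, s₂, .loop_step _ _ _ _ _ _ _ (hfits k s hs) ((htest k s hs).2 hkm) he he', ?_, h2'⟩
    rw [hd]
    rw [show m - (k + 1) = d by omega] at h1'
    linarith [add_mul d 1 (t + c.time)]

end Runs

namespace Prog

/-- The weakest precondition of a program without loops. -/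
def wp (w : ℕ) : Prog → (State → Prop) → State → Prop
  | skip, Q, s => Q s
  | assign x e, Q, s => e.Fits w s ∧ Q (s.setReg x (e.val s))
  | store A i e, Q, s => (i.Fits w s ∧ e.Fits w s) ∧ Q (s.setArr A (i.val s) (e.val s))
  | rassign x e, Q, s => e.Fits w s ∧ Q (s.setRreg x (e.val s))
  | rstore A i e, Q, s => (i.Fits w s ∧ e.Fits w s) ∧ Q (s.setRarr A (i.val s) (e.val s))
  | seq P P', Q, s => P.wp w (P'.wp w Q) s
  | ite c P P', Q, s => c.Fits w s ∧ (c.Holds s → P.wp w Q s) ∧ (¬ c.Holds s → P'.wp w Q s)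
  | loop _ _, _, _ => False

/-- A bound for the running time of a program without loops. -/
def stepBound : Prog → ℕ
  | skip => 1
  | assign _ e => e.time + 1
  | store _ i e => i.time + e.time + 1
  | rassign _ e => e.time + 1
  | rstore _ i e => i.time + e.time + 1
  | seq P P' => P.stepBound + P'.stepBound
  | ite c P P' => c.time + max P.stepBound P'.stepBound
  -- An arbitrary value: `wp` is `False` on loops, so it never serves as a time bound.
  | loop _ _ => 0

end Prog

theorem Runs.of_wp {w : ℕ} {P : Prog} {s : State} {Q : State → Prop} (h : P.wp w Q s) :
    Runs w P s P.stepBound Q := by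
  induction P generalizing s Q with
  | skip => exact ⟨_, _, .skip s, le_rfl, h⟩
  | assign x e => exact ⟨_, _, .assign s x e h.1, le_rfl, h.2⟩
  | store A i e => exact ⟨_, _, .store s A i e h.1.1 h.1.2, le_rfl, h.2⟩
  | rassign x e => exact ⟨_, _, .rassign s x e h.1, le_rfl, h.2⟩
  | rstore A i e => exact ⟨_, _, .rstore s A i e h.1.1 h.1.2, le_rfl, h.2⟩
  | seq P P' ih ih' => exact (ih h).seq fun s' hs' => ih' hs'
  | ite c P P' ih ih' =>
    obtain ⟨hc, h1, h2⟩ := h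
    by_cases hh : c.Holds s
    · obtain ⟨t, s', he, ht, hq⟩ := ih (h1 hh)
      exact ⟨_, s', .ite_pos _ _ _ _ _ _ hc hh he, by simp only [Prog.stepBound]; omega, hq⟩
    · obtain ⟨t, s', he, ht, hq⟩ := ih' (h2 hh)
      exact ⟨_, s', .ite_neg _ _ _ _ _ _ hc hh he, by simp only [Prog.stepBound]; omega, hq⟩
  | loop c P ih => exact h.elim

theorem Runs.of_wp_of_le {w t : ℕ} {P : Prog} {s : State} {Q : State → Prop} (h : P.wp w Q s)
    (ht : P.stepBound ≤ t) : Runs w P s t Q :=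
  (Runs.of_wp h).mono ht fun _ => id

namespace State

variable (s : State) (x y A B i k v : ℕ) (r : ℝ)

@[simp] theorem setReg_reg : (s.setReg x v).reg y = if y = x then v else s.reg y := by
  simp [setReg, Function.update_apply]
@[simp] theorem setReg_arr : (s.setReg x v).arr = s.arr := rfl
@[simp] theorem setReg_rreg : (s.setReg x v).rreg = s.rreg := rfl
@[simp] theorem setReg_rarr : (s.setReg x v).rarr = s.rarr := rfl
@[simp] theorem setRreg_rreg : (s.setRreg x r).rreg y = if y = x then r else s.rreg y := by
  simp [setRreg, Function.update_apply]
@[simp] theorem setRreg_arr : (s.setRreg x r).arr = s.arr := rfl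
@[simp] theorem setRreg_reg : (s.setRreg x r).reg = s.reg := rfl
@[simp] theorem setRreg_rarr : (s.setRreg x r).rarr = s.rarr := rfl
@[simp] theorem setArr_arr :
    (s.setArr A i v).arr B k = if B = A ∧ k = i then v else s.arr B k := by
  by_cases h : B = A
  · subst h; simp [setArr, Function.update_apply]
  · simp [setArr, h]
@[simp] theorem setArr_reg : (s.setArr A i v).reg = s.reg := rfl
@[simp] theorem setArr_rreg : (s.setArr A i v).rreg = s.rreg := rfl
@[simp] theorem setArr_rarr : (s.setArr A i v).rarr = s.rarr := rfl
@[simp] theorem setRarr_rarr :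
    (s.setRarr A i r).rarr B k = if B = A ∧ k = i then r else s.rarr B k := by
  by_cases h : B = A
  · subst h; simp [setRarr, Function.update_apply]
  · simp [setRarr, h]
@[simp] theorem setRarr_reg : (s.setRarr A i r).reg = s.reg := rfl
@[simp] theorem setRarr_rreg : (s.setRarr A i r).rreg = s.rreg := rfl
@[simp] theorem setRarr_arr : (s.setRarr A i r).arr = s.arr := rfl

end State

namespace Prog

variable (w : ℕ) (Q : State → Prop) (s : State)

theorem wp_seq (P P' : Prog) : (seq P P').wp w Q s = P.wp w (P'.wp w Q) s := rfl

theorem wp_assign (x : ℕ) (e : NExp) :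
    (assign x e).wp w Q s = (e.Fits w s ∧ Q (s.setReg x (e.val s))) := rfl

theorem wp_ite (c : Test) (P P' : Prog) : (ite c P P').wp w Q s =
    (c.Fits w s ∧ (c.Holds s → P.wp w Q s) ∧ (¬ c.Holds s → P'.wp w Q s)) := rfl

theorem wp_skip : skip.wp w Q s = Q s := rfl

end Prog

theorem Prog.wp_mono {w : ℕ} {P : Prog} {Q R : State → Prop} {s : State} (h : P.wp w Q s)
    (hQ : ∀ s', Q s' → R s') : P.wp w R s := by
  induction P generalizing s Q R with
  | skip => exact hQ _ h
  | seq P P' ih ih' => exact ih h fun _ h' => ih' h' hQ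
  | ite c P P' ih ih' => exact ⟨h.1, fun hc => ih (h.2.1 hc) hQ, fun hc => ih' (h.2.2 hc) hQ⟩
  | loop => exact h
  | _ => exact ⟨h.1, hQ _ h.2⟩

theorem Runs.ite {w t : ℕ} {c : Test} {P P' : Prog} {s : State} {Q : State → Prop}
    (hc : c.Fits w s) (h : c.Holds s → Runs w P s t Q) (h' : ¬ c.Holds s → Runs w P' s t Q) :
    Runs w (.ite c P P') s (c.time + t) Q := by
  by_cases hh : c.Holds s
  · obtain ⟨a, s', he, ht, hq⟩ := h hh
    exact ⟨_, s', .ite_pos _ _ _ _ _ _ hc hh he, by omega, hq⟩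
  · obtain ⟨a, s', he, ht, hq⟩ := h' hh
    exact ⟨_, s', .ite_neg _ _ _ _ _ _ hc hh he, by omega, hq⟩

/-! ### The program

Keys are made available one by one, in the order of increasing weight; the state after `st` of
them is stage `st`.  In every stage, a record of an optimal tree for every subproblem is computed.
The word registers are used as follows: `0` holds `n`; `1` holds `n + 1`; `2` the stage; `3` and
`7` the numbers `n - i` and `i`, and `4` the number `j`, for the subproblem with the intervals
`i, …, j`; `5` the key of a less-than test; `6` the record of the subproblem; `8` the key
that was added last; `9` a counter; `10` and `11` records of smaller subproblems.
Real array `2` holds the costs and `3` the weights of the recorded trees. Word array `4` marks the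
keys that have been added. -/

namespace Program

/-- The address of the record for a subproblem. -/
def addr (st u j : NExp) : NExp :=
  .add (.mul (.add (.mul (.add st (.lit 1)) (.var 1)) u) (.var 1)) j

/-- Evaluate the less-than test in register `5`. -/
def evalSplit : Prog :=
  .seq (.assign 10 (addr (.var 2) (.var 3) (.var 5))) <|
  .seq (.assign 11 (addr (.var 2) (.sub (.var 0) (.add (.var 5) (.lit 1))) (.var 4))) <|
  .rassign 0 (.add (.add (.add (.read 3 (.var 10)) (.read 3 (.var 11))) (.read 2 (.var 10)))
    (.read 2 (.var 11)))

/-- Record the tree with the less-than test in register `5`. -/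
def storeSplit : Prog :=
  .seq (.store 0 (.var 6) (.lit 3)) <|
  .seq (.store 1 (.var 6) (.var 5)) <|
  .seq (.store 2 (.var 6) (.var 10)) <|
  .seq (.store 3 (.var 6) (.var 11)) <|
  .seq (.rstore 2 (.var 6) (.var 0)) <|
  .rstore 3 (.var 6) (.add (.read 3 (.var 10)) (.read 3 (.var 11)))

/-- Record the leaf for an interval. -/
def storeLeaf : Prog :=
  .seq (.store 0 (.var 6) (.lit 1)) <|
  .seq (.store 1 (.var 6) (.var 7)) <|
  .seq (.rstore 2 (.var 6) .zero) <|
  .rstore 3 (.var 6) (.read 1 (.var 7))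

/-- Record the tree with the equality test for the key added last. -/
def storeEq : Prog :=
  .seq (.store 0 (.var 6) (.lit 2)) <|
  .seq (.store 1 (.var 6) (.var 8)) <|
  .seq (.store 2 (.var 6) (.var 8)) <|
  .seq (.store 3 (.var 6) (.var 10)) <|
  .seq (.rstore 2 (.var 6) (.add (.add (.read 0 (.var 8)) (.read 3 (.var 10)))
    (.read 2 (.var 10)))) <|
  .rstore 3 (.var 6) (.add (.read 0 (.var 8)) (.read 3 (.var 10)))

/-- Copy the record in register `10`. -/
def copyRecord : Prog :=
  .seq (.store 0 (.var 6) (.read 0 (.var 10))) <|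
  .seq (.store 1 (.var 6) (.read 1 (.var 10))) <|
  .seq (.store 2 (.var 6) (.read 2 (.var 10))) <|
  .seq (.store 3 (.var 6) (.read 3 (.var 10))) <|
  .seq (.rstore 2 (.var 6) (.read 2 (.var 10))) <|
  .rstore 3 (.var 6) (.read 3 (.var 10))

/-- Record a first tree for the subproblem. -/
def initCell : Prog :=
  .ite (.eq (.var 2) (.lit 0))
    (.ite (.eq (.var 7) (.var 4)) storeLeaf
      -- The less-than test for key `i` merely supplies a first tree to compare with; the loop in
      -- `cell` tries it again.
      (.seq (.assign 5 (.var 7)) (.seq evalSplit storeSplit)))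
    -- The record for the same `i, …, j` one stage earlier lies `(n + 1) ^ 2` places below.
    (.seq (.assign 10 (.sub (.var 6) (.mul (.var 1) (.var 1))))
      (.ite (.and (.le (.var 7) (.add (.var 8) (.lit 1))) (.le (.add (.var 8) (.lit 1)) (.var 4)))
        storeEq copyRecord))

/-- Try the less-than test in register `5`. -/
def trySplit : Prog :=
  .seq evalSplit <|
  .seq (.ite (.rle (.read 2 (.var 6)) (.var 0)) .skip storeSplit)
    (.assign 5 (.add (.var 5) (.lit 1)))

/-- Solve one subproblem. -/
def cell : Prog :=
  .seq (.seq (.assign 6 (addr (.var 2) (.var 3) (.var 4)))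
    (.seq initCell (.assign 5 (.var 7)))) <|
  .loop (.le (.add (.var 5) (.lit 1)) (.var 4)) trySplit

/-- Solve the subproblems with a given `i`. -/
def row : Prog :=
  .seq (.seq (.assign 7 (.sub (.var 0) (.var 3))) (.assign 4 (.var 7))) <|
  .seq (.loop (.le (.var 4) (.var 0)) (.seq cell (.assign 4 (.add (.var 4) (.lit 1))))) <|
  .assign 3 (.add (.var 3) (.lit 1))

/-- Consider the key in register `9` as the next one to be added. -/
def considerKey : Prog :=
  .seq (.ite (.eq (.read 4 (.var 9)) (.lit 0))
    -- The value `n` in register `8` means that there is no candidate yet.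
    (.ite (.eq (.var 8) (.var 0)) (.assign 8 (.var 9))
      (.ite (.rle (.read 0 (.var 9)) (.read 0 (.var 8))) (.assign 8 (.var 9)) .skip)) .skip)
    (.assign 9 (.add (.var 9) (.lit 1)))

/-- Add the lightest key that has not been added yet. -/
def addKey : Prog :=
  .seq (.seq (.assign 8 (.var 0)) (.assign 9 (.lit 0))) <|
  .seq (.loop (.le (.add (.var 9) (.lit 1)) (.var 0)) considerKey) (.store 4 (.var 8) (.lit 1))

def stage : Prog :=
  .seq (.ite (.eq (.var 2) (.lit 0)) .skip addKey) <|
  .seq (.assign 3 (.lit 0)) <|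
  .seq (.loop (.le (.var 3) (.var 0)) row) (.assign 2 (.add (.var 2) (.lit 1)))

/-- The whole program. -/
def main : Prog :=
  .seq (.assign 1 (.add (.var 0) (.lit 1))) <|
  .seq (.loop (.le (.add (.var 9) (.lit 1)) (.var 0))
    -- Record `b < n` becomes the leaf of key `b`. Its type code `0` is the initial content of array
    -- `0`, so only the index is written.
    (.seq (.store 1 (.var 9) (.var 9)) (.assign 9 (.add (.var 9) (.lit 1))))) <|
  .seq (.loop (.le (.var 2) (.var 0)) stage) <|
  -- The address is evaluated while register `0` still holds `n`: stage `n`, `n - i = n`, `j = n`,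
  -- which is the full problem.
  .seq (.assign 0 (addr (.var 0) (.var 0) (.var 0))) (.rassign 0 (.read 2 (.var 0)))

end Program

/-! ### Records -/

/-- The record for the intervals `i, …, j` in stage `st`. -/
def idx (n st i j : ℕ) : ℕ := ((st + 1) * (n + 1) + (n - i)) * (n + 1) + j

/-- Together with the next inequalities: records are numbered lexicographically by stage, decreasing
`i` and increasing `j`, so every subproblem comes after those it uses. The offset `st + 1` reserves
the smallest addresses for the leaves of the keys. -/
theorem idx_lt_right {st i j j' : ℕ} (h : j < j') : idx n st i j < idx n st i j' := by
  unfold idx; omega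

theorem idx_lt_left {st i i' j j' : ℕ} (h : i' < i) (hi : i ≤ n) (hj : j ≤ n) :
    idx n st i j < idx n st i' j' := by
  unfold idx
  have : ((st + 1) * (n + 1) + (n - i) + 1) * (n + 1) ≤
      ((st + 1) * (n + 1) + (n - i')) * (n + 1) := Nat.mul_le_mul_right _ (by omega)
  linarith [add_mul ((st + 1) * (n + 1) + (n - i)) 1 (n + 1)]

theorem idx_lt_stage {st i i' j j' : ℕ} (hj : j ≤ n) :
    idx n st i j < idx n (st + 1) i' j' := by
  unfold idx
  have : ((st + 1) * (n + 1) + (n - i) + 1) * (n + 1) ≤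
      ((st + 1 + 1) * (n + 1) + (n - i')) * (n + 1) :=
    Nat.mul_le_mul_right _ (by rw [add_mul (st + 1)]; omega)
  linarith [add_mul ((st + 1) * (n + 1) + (n - i)) 1 (n + 1)]

theorem idx_succ (st i j : ℕ) : idx n (st + 1) i j = idx n st i j + (n + 1) * (n + 1) := by
  unfold idx; ring

theorem lt_idx (st i j : ℕ) : n < idx n st i j := by
  unfold idx
  have : 1 * (n + 1) ≤ ((st + 1) * (n + 1) + (n - i)) * (n + 1) :=
    Nat.mul_le_mul_right _ (by nlinarith)
  omega

def Cmp.code : Cmp → ℕ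
  | .eq => 2
  | .lt => 3

/-- The record `p` represents the tree, and pointers always decrease. -/
def State.RepBelow (s : State) : ℕ → Tree n → Prop
  | p, .leaf (.key b) => s.arr 0 p = 0 ∧ s.arr 1 p = b.val
  | p, .leaf (.gap a) => s.arr 0 p = 1 ∧ s.arr 1 p = a.val
  | p, .node c b yes no => s.arr 0 p = c.code ∧ s.arr 1 p = b.val ∧ s.arr 2 p < p ∧ s.arr 3 p < p ∧
      s.RepBelow (s.arr 2 p) yes ∧ s.RepBelow (s.arr 3 p) no

theorem State.RepBelow.represents {s : State} {p : ℕ} {T : Tree n} (h : s.RepBelow p T) :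
    s.Represents p T := by
  induction T generalizing p with
  | leaf l => cases l <;> exact h
  | node c b Y N ihY ihN =>
    obtain ⟨h1, h2, -, -, h3, h4⟩ := h
    cases c <;> exact ⟨h1, h2, ihY h3, ihN h4⟩

/-- As pointers decrease, the tree at `p` occupies cells up to `p` only, and writes above `p` cannot
damage it. -/
theorem State.RepBelow.congr {s s' : State} {p : ℕ} {T : Tree n} (h : s.RepBelow p T)
    (hs : ∀ B k, k ≤ p → s'.arr B k = s.arr B k) : s'.RepBelow p T := by
  induction T generalizing p with
  | leaf l => cases l <;> simpa only [RepBelow, hs _ _ le_rfl] using h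
  | node c b Y N ihY ihN =>
    obtain ⟨h1, h2, h3, h4, h5, h6⟩ := h
    simp only [RepBelow, hs _ _ le_rfl]
    exact ⟨h1, h2, h3, h4, ihY h5 fun B k hk => hs B k (hk.trans h3.le),
      ihN h6 fun B k hk => hs B k (hk.trans h4.le)⟩

theorem State.RepBelow.copy {s s' : State} {p q : ℕ} {T : Tree n} (h : s.RepBelow q T)
    (hqp : q < p) (hp : ∀ B < 4, s'.arr B p = s.arr B q)
    (hs : ∀ B k, k < p → s'.arr B k = s.arr B k) : s'.RepBelow p T := by
  cases T with
  | leaf l => cases l <;> simpa [RepBelow, hp] using h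
  | node c b Y N =>
    obtain ⟨h1, h2, h3, h4, h5, h6⟩ := h
    simp only [RepBelow, hp 0 (by omega), hp 1 (by omega), hp 2 (by omega), hp 3 (by omega)]
    exact ⟨h1, h2, h3.trans hqp, h4.trans hqp, h5.congr fun B k hk => hs B k (by omega),
      h6.congr fun B k hk => hs B k (by omega)⟩

/-- The record `p` holds the tree with its cost and weight. -/
def Records (I : Inst K n) (s : State) (p : ℕ) (T : Tree n) : Prop :=
  s.RepBelow p T ∧ s.rarr 2 p = I.cost T ∧ s.rarr 3 p = I.wt T

/-- The record `p` holds an optimal tree for a subproblem. -/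
def CellOK (I : Inst K n) (s : State) (p : ℕ) (A : Finset (Fin n)) (i j : ℕ) : Prop :=
  ∃ T, Valid A i j T ∧ (∀ T', Valid A i j T' → I.cost T ≤ I.cost T') ∧ Records I s p T

/-- The state has changed only in the record `p` and in auxiliary registers. -/
structure Frame (p : ℕ) (s s' : State) : Prop where
  reg : ∀ x, x ≠ 5 → x ≠ 6 → x ≠ 10 → x ≠ 11 → s'.reg x = s.reg x
  arr : ∀ B k, B = 4 ∨ k ≠ p → s'.arr B k = s.arr B k
  rarr : ∀ B k, B = 0 ∨ B = 1 ∨ k ≠ p → s'.rarr B k = s.rarr B k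

theorem Frame.trans {p : ℕ} {s s' s'' : State} (h : Frame p s s') (h' : Frame p s' s'') :
    Frame p s s'' where
  reg x h1 h2 h3 h4 := (h'.reg x h1 h2 h3 h4).trans (h.reg x h1 h2 h3 h4)
  arr B k hB := (h'.arr B k hB).trans (h.arr B k hB)
  rarr B k hB := (h'.rarr B k hB).trans (h.rarr B k hB)

theorem Frame.records {I : Inst K n} {p q : ℕ} {s s' : State} {T : Tree n} (h : Frame p s s')
    (hq : q < p) (hr : Records I s q T) : Records I s' q T := by
  obtain ⟨h1, h2, h3⟩ := hr
  refine ⟨h1.congr fun B k hk => h.arr B k (.inr (by omega)), ?_, ?_⟩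
  · rwa [h.rarr 2 q (.inr (.inr hq.ne))]
  · rwa [h.rarr 3 q (.inr (.inr hq.ne))]

theorem Frame.cellOK {I : Inst K n} {p q : ℕ} {s s' : State} {A : Finset (Fin n)} {i j : ℕ}
    (h : Frame p s s') (hq : q < p) (hr : CellOK I s q A i j) : CellOK I s' q A i j := by
  obtain ⟨T, h1, h2, h3⟩ := hr
  exact ⟨T, h1, h2, h.records hq h3⟩

/-- The facts that hold throughout the main part of the program. -/
structure Base (I : Inst K n) (s : State) : Prop where
  reg0 : s.reg 0 = n
  reg1 : s.reg 1 = n + 1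
  key_weight : ∀ b : Fin n, s.rarr 0 b.val = I.β b
  gap_weight : ∀ a : Fin (n + 1), s.rarr 1 a.val = I.α a
  key_leaf : ∀ k < n, s.arr 0 k = 0 ∧ s.arr 1 k = k

/-- The facts that hold while the records of stage `st` are computed. -/
structure StageCtx (I : Inst K n) (st : ℕ) (A : Finset (Fin n)) (s : State) : Prop
    extends Base I s where
  le : st ≤ n
  reg2 : s.reg 2 = st
  mark : ∀ b : Fin n, s.arr 4 b.val = 0 ↔ b ∉ A
  last : (st = 0 ∧ A = ∅) ∨ 0 < st ∧ ∃ h : Fin n, s.reg 8 = h.val ∧ h ∈ A ∧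
    (∀ f ∈ A, I.β f ≤ I.β h) ∧
    ∀ i j, i ≤ j → j ≤ n → CellOK I s (idx n (st - 1) i j) (A.erase h) i j

/-- The records that precede the one for `i, …, j` in stage `st` have been computed. -/
def Done (I : Inst K n) (st : ℕ) (A : Finset (Fin n)) (i j : ℕ) (s : State) : Prop :=
  ∀ i' j', i' ≤ j' → j' ≤ n → (i < i' ∨ i' = i ∧ j' < j) → CellOK I s (idx n st i' j') A i' j'

theorem Frame.base {I : Inst K n} {p : ℕ} {s s' : State} (h : Frame p s s') (hp : n < p)
    (hb : Base I s) : Base I s' where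
  reg0 := by rw [h.reg 0 (by simp) (by simp) (by simp) (by simp), hb.reg0]
  reg1 := by rw [h.reg 1 (by simp) (by simp) (by simp) (by simp), hb.reg1]
  key_weight b := by rw [h.rarr 0 _ (.inl rfl), hb.key_weight]
  gap_weight b := by rw [h.rarr 1 _ (.inr (.inl rfl)), hb.gap_weight]
  key_leaf k hk := by
    rw [h.arr 0 _ (.inr (by omega)), h.arr 1 _ (.inr (by omega))]
    exact hb.key_leaf k hk

theorem Frame.stageCtx {I : Inst K n} {st i j : ℕ} {A : Finset (Fin n)} {s s' : State}
    (h : Frame (idx n st i j) s s') (hc : StageCtx I st A s) : StageCtx I st A s' where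
  toBase := h.base (lt_idx _ _ _) hc.toBase
  le := hc.le
  reg2 := by rw [h.reg 2 (by simp) (by simp) (by simp) (by simp), hc.reg2]
  mark b := by rw [h.arr 4 _ (.inl rfl), hc.mark]
  last := by
    refine hc.last.imp_right fun ⟨h0, k, h1, h2, h3, h4⟩ => ⟨h0, k, ?_, h2, h3, ?_⟩
    · rw [h.reg 8 (by simp) (by simp) (by simp) (by simp), h1]
    · intro i' j' hi hj
      refine h.cellOK ?_ (h4 i' j' hi hj)
      obtain ⟨st, rfl⟩ := Nat.exists_eq_succ_of_ne_zero h0.ne'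
      exact idx_lt_stage hj

theorem Frame.done {I : Inst K n} {st i j : ℕ} {A : Finset (Fin n)} {s s' : State}
    (h : Frame (idx n st i j) s s') (hd : Done I st A i j s) : Done I st A i j s' := by
  intro i' j' hi hj hlt
  refine h.cellOK ?_ (hd i' j' hi hj hlt)
  rcases hlt with hlt | ⟨rfl, hlt⟩
  · exact idx_lt_left hlt (by omega) hj
  · exact idx_lt_right hlt

/-! ### Verification -/

/-! ### Address bounds and the straight-line blocks -/

theorem addr_bounds {w st u j : ℕ} (hw : 4 * (n + 1) ^ 3 ≤ w) (hst : st ≤ n) (hu : u ≤ n)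
    (hj : j ≤ n) :
    st + 1 ≤ w ∧ (st + 1) * (n + 1) ≤ w ∧ (st + 1) * (n + 1) + u ≤ w ∧
      ((st + 1) * (n + 1) + u) * (n + 1) ≤ w ∧ ((st + 1) * (n + 1) + u) * (n + 1) + j ≤ w := by
  have h1 : (st + 1) * (n + 1) ≤ (n + 1) * (n + 1) := Nat.mul_le_mul_right _ (by omega)
  have h2 : ((st + 1) * (n + 1) + u) * (n + 1) ≤ ((n + 1) * (n + 1) + (n + 1)) * (n + 1) :=
    Nat.mul_le_mul_right _ (by omega)
  have h3 : 1 ≤ n + 1 := by omega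
  have h4 : (n + 1) * 1 ≤ (n + 1) * (n + 1) := Nat.mul_le_mul_left _ h3
  have h5 : (n + 1) * (n + 1) * 1 ≤ (n + 1) * (n + 1) * (n + 1) := Nat.mul_le_mul_left _ h3
  have h6 : (n + 1) ^ 3 = (n + 1) * (n + 1) * (n + 1) := by ring
  have h7 : ((n + 1) * (n + 1) + (n + 1)) * (n + 1) =
    (n + 1) * (n + 1) * (n + 1) + (n + 1) * (n + 1) := by ring
  rw [h6] at hw
  refine ⟨?_, ?_, ?_, ?_, ?_⟩ <;> omega

theorem word_bounds {w : ℕ} (hw : 4 * (n + 1) ^ 3 ≤ w) :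
    n + 1 ≤ w ∧ 4 ≤ w ∧ (n + 1) * (n + 1) ≤ w := by
  have h1 := addr_bounds hw (le_refl n) (le_refl n) (le_refl n)
  have h2 : 0 < (n + 1) ^ 3 := by positivity
  exact ⟨h1.1, by omega, h1.2.1⟩

/-- Two states agree in their arrays, and in their word registers other than `5`, `10`, `11`. -/
structure SameArrays (s s' : State) : Prop where
  arr : s'.arr = s.arr
  rarr : s'.rarr = s.rarr
  reg : ∀ x, x ≠ 5 → x ≠ 10 → x ≠ 11 → s'.reg x = s.reg x

theorem SameArrays.frame {s s' : State} (h : SameArrays s s') (p : ℕ) : Frame p s s' where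
  reg x h1 _ h3 h4 := h.reg x h1 h3 h4
  arr B k _ := by rw [h.arr]
  rarr B k _ := by rw [h.rarr]

theorem SameArrays.records {I : Inst K n} {s s' : State} (h : SameArrays s s') {p : ℕ} {T : Tree n}
    (hr : Records I s p T) : Records I s' p T :=
  (h.frame (p + 1)).records (Nat.lt_succ_self p) hr

theorem evalSplit_wp {w : ℕ} (hw : 4 * (n + 1) ^ 3 ≤ w) {I : Inst K n} {s : State} {st i j k : ℕ}
    (hb : Base I s) (h2 : s.reg 2 = st) (hst : st ≤ n) (h3 : s.reg 3 = n - i) (h4 : s.reg 4 = j)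
    (hj : j ≤ n) (h5 : s.reg 5 = k) (hk : k < j) :
    Program.evalSplit.wp w (fun s' => SameArrays s s' ∧ s'.reg 5 = k ∧
      s'.reg 10 = idx n st i k ∧ s'.reg 11 = idx n st (k + 1) j ∧
      s'.rreg 0 = s.rarr 3 (idx n st i k) + s.rarr 3 (idx n st (k + 1) j) +
        s.rarr 2 (idx n st i k) + s.rarr 2 (idx n st (k + 1) j)) s := by
  have b1 := addr_bounds (u := n - i) (j := k) hw hst (by omega) (by omega)
  have b2 := addr_bounds (u := n - (k + 1)) (j := j) hw hst (by omega) (by omega)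
  have b3 := word_bounds hw
  simp [Program.evalSplit, Prog.wp, Program.addr, NExp.Fits, NExp.val, RExp.Fits, RExp.val,
    hb.reg0, hb.reg1, h2, h3, h4, h5, idx]
  refine ⟨by omega, by omega, rfl, rfl, ?_⟩
  intro x hx5 hx10 hx11
  simp [hx10, hx11]

theorem storeSplit_wp {w : ℕ} (hw : 4 ≤ w) {I : Inst K n} {s : State} {p q r : ℕ} {b : Fin n}
    {L R : Tree n} (h5 : s.reg 5 = b.val) (h6 : s.reg 6 = p) (h10 : s.reg 10 = q)
    (h11 : s.reg 11 = r) (hq : q < p) (hr : r < p) (hL : Records I s q L) (hR : Records I s r R)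
    (hc : s.rreg 0 = I.cost (.node .lt b L R)) :
    Program.storeSplit.wp w (fun s' => Frame p s s' ∧ s'.reg = s.reg ∧
      Records I s' p (.node .lt b L R)) s := by
  simp only [Program.storeSplit, Prog.wp, NExp.Fits, RExp.Fits, NExp.val, RExp.val, true_and,
    State.setArr_reg, State.setRarr_reg, h5, h6, h10, h11]
  refine ⟨by omega, ?_⟩
  have hF : ∀ v, Frame p s ((((((s.setArr 0 p 3).setArr 1 p b.val).setArr 2 p q).setArr 3 p
      r).setRarr
      2 p (s.rreg 0)).setRarr 3 p v) := fun v => by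
    constructor
    · intros; rfl
    · rintro B k (rfl | hk)
      · simp
      · simp [hk]
    · rintro B k (rfl | rfl | hk)
      · simp
      · simp
      · simp [hk]
  refine ⟨hF _, ⟨?_, ?_, ?_, ?_, ?_, ?_⟩, ?_, ?_⟩
  · simp [Cmp.code]
  · simp
  · simpa using hq
  · simpa using hr
  · simpa using hL.1.congr fun B k hk => by simp [show k ≠ p by omega]
  · simpa using hR.1.congr fun B k hk => by simp [show k ≠ p by omega]
  · simpa using hc
  · simp [hL.2.2, hR.2.2, Inst.wt]

theorem storeLeaf_wp {w : ℕ} (hw : 4 ≤ w) {I : Inst K n} {s : State} {p : ℕ} {a : Fin (n + 1)}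
    (h6 : s.reg 6 = p) (h7 : s.reg 7 = a.val) (ha : s.rarr 1 a.val = I.α a) :
    Program.storeLeaf.wp w (fun s' => Frame p s s' ∧ s'.reg = s.reg ∧
      Records I s' p (.leaf (.gap a))) s := by
  simp only [Program.storeLeaf, Prog.wp, NExp.Fits, RExp.Fits, NExp.val, RExp.val, true_and,
    State.setArr_reg, State.setRarr_reg, h6, h7]
  refine ⟨by omega, ⟨?_, ?_, ?_⟩, ⟨?_, ?_⟩, ?_, ?_⟩
  · intros; rfl
  · rintro B k (rfl | hk)
    · simp
    · simp [hk]
  · rintro B k (rfl | rfl | hk)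
    · simp
    · simp
    · simp [hk]
  · simp
  · simp
  · simp [I.cost_leaf]
  · simp [ha, Inst.wt, Inst.weight]

theorem storeEq_wp {w : ℕ} (hw : 4 ≤ w) {I : Inst K n} {s : State} {p q : ℕ} {h : Fin n}
    {U : Tree n} (hb : Base I s) (h6 : s.reg 6 = p) (h8 : s.reg 8 = h.val) (h10 : s.reg 10 = q)
    (hp : n < p) (hq : q < p) (hU : Records I s q U) :
    Program.storeEq.wp w (fun s' => Frame p s s' ∧ s'.reg = s.reg ∧
      Records I s' p (.node .eq h (.leaf (.key h)) U)) s := by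
  simp only [Program.storeEq, Prog.wp, NExp.Fits, RExp.Fits, NExp.val, RExp.val, true_and,
    State.setArr_reg, State.setRarr_reg, h6, h8, h10]
  refine ⟨by omega, ?_⟩
  have hF : ∀ v v', Frame p s ((((((s.setArr 0 p 2).setArr 1 p h.val).setArr 2 p h.val).setArr 3 p
      q).setRarr 2 p v).setRarr 3 p v') := fun v v' => by
    constructor
    · intros; rfl
    · rintro B k (rfl | hk)
      · simp
      · simp [hk]
    · rintro B k (rfl | rfl | hk)
      · simp
      · simp
      · simp [hk]
  have hk := hb.key_leaf h.val h.isLt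
  -- The positive child is record `h` itself, the key leaf written at the start.
  have hhp : h.val ≠ p := by omega
  refine ⟨hF _ _, ⟨?_, ?_, ?_, ?_, ?_, ?_⟩, ?_, ?_⟩
  · simp [Cmp.code]
  · simp
  · simp; omega
  · simpa using hq
  · simp [State.RepBelow, hk, hhp]
  · simpa using hU.1.congr fun B k hk => by simp [show k ≠ p by omega]
  · simp [hU.2.1, hU.2.2, I.cost_node, I.cost_leaf, Inst.wt, Inst.weight, hb.key_weight]
  · simp [hU.2.2, Inst.wt, Inst.weight, hb.key_weight, hq.ne]

theorem copyRecord_wp {w : ℕ} {I : Inst K n} {s : State} {p q : ℕ}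
    {T : Tree n} (h6 : s.reg 6 = p) (h10 : s.reg 10 = q) (hq : q < p) (hT : Records I s q T) :
    Program.copyRecord.wp w (fun s' => Frame p s s' ∧ s'.reg = s.reg ∧ Records I s' p T) s := by
  simp only [Program.copyRecord, Prog.wp, NExp.Fits, RExp.Fits, NExp.val, RExp.val, true_and,
    State.setArr_reg, State.setRarr_reg, h6, h10]
  refine ⟨⟨?_, ?_, ?_⟩, hT.1.copy hq ?_ ?_, ?_, ?_⟩
  · intros; rfl
  · rintro B k (rfl | hk)
    · simp
    · simp [hk]
  · rintro B k (rfl | rfl | hk)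
    · simp
    · simp
    · simp [hk]
  · intro B hB
    interval_cases B <;> simp [hq.ne]
  · intro B k hk
    simp [hk.ne]
  · simp [hT.2.1]
  · simp [hT.2.2, hq.ne]

/-- The record of the subproblem holds a tree that costs no more than any tree that is not beaten
by one with a less-than test at its root. -/
structure Start (I : Inst K n) (st i j : ℕ) (A : Finset (Fin n)) (T : Tree n) (s s' : State) :
    Prop where
  frame : Frame (idx n st i j) s s'
  reg6 : s'.reg 6 = idx n st i j
  valid : Valid A i j T
  records : Records I s' (idx n st i j) T
  le : ∀ T', Valid A i j T' → I.cost T ≤ I.cost T' ∨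
    ∃ d L R, Valid A i j (.node .lt d L R) ∧ I.cost (.node .lt d L R) ≤ I.cost T'

/-! ### Solving one subproblem -/

section Cell

variable {w : ℕ} {I : Inst K n} {s s₁ : State} {st i j : ℕ} {A : Finset (Fin n)}

/-- The cost of the tree with a given less-than test at the root and optimal subtrees. -/
theorem split_cost {k : ℕ} (hk : k < n) {s : State} (hL : CellOK I s (idx n st i k) A i k)
    (hR : CellOK I s (idx n st (k + 1) j) A (k + 1) j) :
    ∃ L R, Valid A i k L ∧ Valid A (k + 1) j R ∧ Records I s (idx n st i k) L ∧
      Records I s (idx n st (k + 1) j) R ∧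
      s.rarr 3 (idx n st i k) + s.rarr 3 (idx n st (k + 1) j) + s.rarr 2 (idx n st i k) +
        s.rarr 2 (idx n st (k + 1) j) = I.cost (.node .lt ⟨k, hk⟩ L R) ∧
      ∀ L' R', Valid A i j (.node .lt ⟨k, hk⟩ L' R') →
        I.cost (.node .lt ⟨k, hk⟩ L R) ≤ I.cost (.node .lt ⟨k, hk⟩ L' R') := by
  obtain ⟨L, hL, hLo, hLr⟩ := hL
  obtain ⟨R, hR, hRo, hRr⟩ := hR
  refine ⟨L, R, hL, hR, hLr, hRr, ?_, fun L' R' h => ?_⟩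
  · rw [hLr.2.1, hLr.2.2, hRr.2.1, hRr.2.2, I.cost_node]
  · obtain ⟨-, -, hL', hR'⟩ := h.of_lt
    rw [I.cost_node, I.cost_node]
    linarith [hL.wt_eq I hL', hR.wt_eq I hR', hLo L' hL', hRo R' hR']

/-- If the key `h` added last is in range, `Valid.exchange` leaves as competitors only trees with a
less-than root and trees testing `h` first, and the best of the latter continues with the optimum of
the previous stage. If `h` is out of range, the subproblem is the same as in the previous stage. -/
theorem initCell_wp (hw : 4 * (n + 1) ^ 3 ≤ w) (hc : StageCtx I st A s) (hd : Done I st A i j s)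
    (hij : i ≤ j) (hj : j ≤ n) (h3 : s.reg 3 = n - i) (h4 : s.reg 4 = j) (h7 : s.reg 7 = i)
    (h6 : s.reg 6 = idx n st i j) :
    Program.initCell.wp w (fun s' => ∃ T, Start I st i j A T s s') s := by
  obtain ⟨b1, b2, b3⟩ := word_bounds hw
  have hb := hc.toBase
  simp only [Program.initCell, Prog.wp_seq, Prog.wp_ite, Prog.wp_assign, Test.Fits, Test.Holds,
      NExp.Fits, NExp.val, hc.reg2, h4, h7,
    true_and]
  refine ⟨by omega, fun h0 => ⟨fun hij' => ?_, fun hij' => ?_⟩, fun h0 => ?_⟩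
  · subst hij'
    have hA : A = ∅ := by
      rcases hc.last with h | h
      · exact h.2
      · omega
    subst hA
    refine Prog.wp_mono (storeLeaf_wp (I := I) b2 (a := ⟨i, by omega⟩) h6 h7
        (hb.gap_weight ⟨i, by omega⟩))
      fun s' ⟨f, hreg, hr⟩ => ⟨_, f, by rw [hreg, h6], .leaf (A := ∅) ⟨i, by omega⟩ (by simp), hr,
          fun T' _ => ?_⟩
    rw [I.cost_leaf]
    exact .inl (I.cost_nonneg T')
  · have hA : A = ∅ := by
      rcases hc.last with h | h
      · exact h.2
      · omega
    subst hA
    have hij' : i < j := by omega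
    obtain ⟨L, R, hL, hR, hLr, hRr, hcost, -⟩ := split_cost (I := I) (show i < n by omega)
      (hd i i le_rfl (by omega) (.inr ⟨rfl, hij'⟩)) (hd (i + 1) j hij' hj (.inl (by omega)))
    have hs₁ : SameArrays s (s.setReg 5 i) := ⟨rfl, rfl, fun x hx _ _ => by simp [hx]⟩
    refine Prog.wp_mono (evalSplit_wp (I := I) (i := i) (k := i) hw
        ((hs₁.frame _).base (lt_idx st i j) hb) (by simp [hc.reg2])
      hc.le (by simp [h3]) (by simp [h4]) hj (by simp) hij') fun s₂ ⟨e1, e5, e10, e11, ec⟩ => ?_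
    refine Prog.wp_mono (storeSplit_wp (I := I) b2 (b := ⟨i, by omega⟩) e5
      (by rw [e1.reg 6 (by simp) (by simp) (by simp)]; simpa using h6) e10 e11
      (idx_lt_right hij') (idx_lt_left (by omega) (by omega) hj)
      (e1.records (hs₁.records hLr)) (e1.records (hs₁.records hRr)) (ec.trans hcost))
      fun s' ⟨f, hreg, hr⟩ => ⟨_, ((hs₁.frame _).trans (e1.frame _)).trans f, ?_, .lt le_rfl hij'
          hL hR, hr,
        fun T' hT' => .inr ?_⟩
    · rw [hreg, e1.reg 6 (by simp) (by simp) (by simp)]; simpa using h6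
    -- Without keys and with more than one interval, every valid tree has a less-than root.
    · cases hT' with
      | leaf => omega
      | eq he => simp at he
      | lt h1 h2 h3 h4 => exact ⟨_, _, _, .lt h1 h2 h3 h4, le_rfl⟩
  · obtain ⟨hst, h, h8, hA, hmax, hprev⟩ : 0 < st ∧ _ := hc.last.resolve_left fun h => h0 h.1
    have hb1 := hb.reg1
    have hq : idx n st i j - (n + 1) * (n + 1) = idx n (st - 1) i j := by
      obtain ⟨st, rfl⟩ := Nat.exists_eq_succ_of_ne_zero h0
      simp [idx_succ]
    have hqp : idx n (st - 1) i j < idx n st i j := by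
      obtain ⟨st, rfl⟩ := Nat.exists_eq_succ_of_ne_zero h0
      exact idx_lt_stage hj
    have hs₁ : SameArrays s (s.setReg 10 (idx n (st - 1) i j)) :=
      ⟨rfl, rfl, fun x _ hx _ => by simp [hx]⟩
    obtain ⟨U, hU, hUo, hUr⟩ := hprev i j hij hj
    simp only [hb1, h6, hq, State.setReg_reg]
    have hlt := h.isLt
    refine ⟨b3, ?_⟩
    simp only [h4, h7, h8, Nat.reduceEqDiff, if_false, and_true]
    refine ⟨by omega, fun hr => ?_, fun hr => ?_⟩
    · refine Prog.wp_mono (storeEq_wp (I := I) b2 (h := h) ((hs₁.frame _).base (lt_idx st i j) hb)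
          (by simpa using h6)
        (by simpa using h8) (by simp) (lt_idx st i j) hqp (hs₁.records hUr))
        fun s' ⟨f, hreg, hr'⟩ => ⟨_, (hs₁.frame _).trans f, by rw [hreg]; simpa using h6,
          .eq hA hr hU, hr', fun T' hT' => ?_⟩
      refine (hT'.exchange I hA hr fun f hf _ => hmax f hf).imp_left fun ⟨U', hU', hc'⟩ => ?_
      rw [I.cost_node] at hc' ⊢
      linarith [hU.wt_eq I hU', hUo U' hU']
    · have hcongr : ∀ e, InRange i j e → (e ∈ A.erase h ↔ e ∈ A) := fun e he => by
        have : e ≠ h := by rintro rfl; exact hr he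
        simp [this]
      refine Prog.wp_mono (copyRecord_wp (I := I) (by simpa using h6) (by simp) hqp
          (hs₁.records hUr))
        fun s' ⟨f, hreg, hr'⟩ => ⟨U, (hs₁.frame _).trans f, by rw [hreg]; simpa using h6,
          hU.congr hcongr, hr', fun T' hT' => .inl (hUo T'
              (hT'.congr fun e he => (hcongr e he).symm))⟩

/-- The invariant of the loop over the less-than tests. -/
def SplitInv (I : Inst K n) (st i j : ℕ) (A : Finset (Fin n)) (s : State) (k : ℕ) (s' : State) :
    Prop :=
  (i ≤ k ∧ k ≤ j) ∧ s'.reg 5 = k ∧ ∃ T, Start I st i j A T s s' ∧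
    ∀ d L R, Valid A i j (.node .lt d L R) → d.val < k → I.cost T ≤ I.cost (.node .lt d L R)

theorem trySplit_wp (hw : 4 * (n + 1) ^ 3 ≤ w) (hc : StageCtx I st A s) (hd : Done I st A i j s)
    (hj : j ≤ n) (h3 : s.reg 3 = n - i) (h4 : s.reg 4 = j) {k : ℕ} (hk : k < j)
    (hs : SplitInv I st i j A s k s₁) :
    Program.trySplit.wp w (SplitInv I st i j A s (k + 1)) s₁ := by
  obtain ⟨⟨hik, -⟩, h5, T, ⟨hF, h6, hT, hTr, hTle⟩, hTk⟩ := hs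
  obtain ⟨b1, b2, b3⟩ := word_bounds hw
  have hd₁ := hF.done hd
  have hc₁ := hF.stageCtx hc
  obtain ⟨L, R, hL, hR, hLr, hRr, hcost, hopt⟩ := split_cost (I := I) (show k < n by omega)
    (hd₁ i k hik (by omega) (.inr ⟨rfl, hk⟩)) (hd₁ (k + 1) j hk hj (.inl (by omega)))
  simp only [Program.trySplit, Prog.wp_seq]
  refine Prog.wp_mono (evalSplit_wp (I := I) hw hc₁.toBase hc₁.reg2 hc.le (i := i)
    (by rw [hF.reg 3 (by simp) (by simp) (by simp) (by simp), h3])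
    (by rw [hF.reg 4 (by simp) (by simp) (by simp) (by simp), h4]) hj h5 hk)
    fun s₂ ⟨e1, e5, e10, e11, ec⟩ => ?_
  rw [hcost] at ec
  have e6 : s₂.reg 6 = idx n st i j := by rw [e1.reg 6 (by simp) (by simp) (by simp), h6]
  -- The common end of both branches; `T'` is the cheaper of the old tree and the best one with the
  -- less-than test for `k`.
  have hinc : ∀ s', s'.reg 5 = k → s'.reg 6 = idx n st i j → Frame (idx n st i j) s s' →
      ∀ T', Valid A i j T' → Records I s' (idx n st i j) T' → I.cost T' ≤ I.cost T →
      I.cost T' ≤ I.cost (.node .lt ⟨k, by omega⟩ L R) →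
      (NExp.add (.var 5) (.lit 1)).Fits w s' ∧
        SplitInv I st i j A s (k + 1) (s'.setReg 5 ((NExp.add (.var 5) (.lit 1)).val s')) := by
    intro s' h5' h6' hF' T' hT' hr' hle hle'
    have hs' : SameArrays s' (s'.setReg 5 (k + 1)) := ⟨rfl, rfl, fun x hx _ _ => by simp [hx]⟩
    simp only [NExp.Fits, NExp.val, h5', true_and]
    refine ⟨by omega, ⟨by omega, by omega⟩, by simp, T',
        ⟨hF'.trans (hs'.frame _), by simpa using h6', hT',
      hs'.records hr', fun T'' hT'' => (hTle T'' hT'').imp_left hle.trans⟩,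
      fun d L' R' hv hdk => ?_⟩
    rcases Nat.lt_succ_iff_lt_or_eq.1 hdk with hdk | rfl
    · exact hle.trans (hTk d L' R' hv hdk)
    · exact hle'.trans (hopt L' R' hv)
  have hfits : (Test.rle (.read 2 (.var 6)) (.var 0)).Fits w s₂ := ⟨trivial, trivial⟩
  have hholds : (Test.rle (.read 2 (.var 6)) (.var 0)).Holds s₂ ↔
      I.cost T ≤ I.cost (.node .lt ⟨k, by omega⟩ L R) := by
    simp only [Test.Holds, NExp.val, RExp.val, e6, ec, e1.rarr, hTr.2.1]
  rw [Prog.wp_seq, Prog.wp_ite, hholds]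
  refine ⟨hfits, fun hle => ?_, fun hle => ?_⟩
  · exact hinc s₂ e5 e6 (hF.trans (e1.frame _)) T hT (e1.records hTr) le_rfl hle
  · refine Prog.wp_mono (storeSplit_wp (I := I) b2 (b := ⟨k, by omega⟩) e5 e6 e10 e11
      (idx_lt_right hk) (idx_lt_left (by omega) (by omega) hj) (e1.records hLr) (e1.records hRr) ec)
      fun s' ⟨f, hreg, hr⟩ => hinc s' (by rw [hreg, e5]) (by rw [hreg, e6])
        ((hF.trans (e1.frame _)).trans f) _ (.lt hik hk hL hR) hr (not_le.1 hle).le le_rfl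

theorem cell_runs (hw : 4 * (n + 1) ^ 3 ≤ w) (hc : StageCtx I st A s) (hd : Done I st A i j s)
    (hij : i ≤ j) (hj : j ≤ n) (h3 : s.reg 3 = n - i) (h4 : s.reg 4 = j) (h7 : s.reg 7 = i) :
    Runs w Program.cell s (300 * (n + 1)) (fun s' => Frame (idx n st i j) s s' ∧
      CellOK I s' (idx n st i j) A i j) := by
  have b1 := addr_bounds (u := n - i) (j := j) hw hc.le (by omega) hj
  have b2 := word_bounds hw
  have hinit : Runs w (.seq (.assign 6 (Program.addr (.var 2) (.var 3) (.var 4)))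
      (.seq Program.initCell (.assign 5 (.var 7)))) s 130 (SplitInv I st i j A s i) := by
    -- Numerical time constants such as `130` are upper bounds for `stepBound`, which `decide`
    -- evaluates.
    refine Runs.of_wp_of_le ?_ (by decide)
    have hF : Frame (idx n st i j) s (s.setReg 6 (idx n st i j)) :=
      ⟨fun x _ hx _ _ => by simp [hx], fun _ _ _ => rfl, fun _ _ _ => rfl⟩
    simp only [Prog.wp_seq, Prog.wp_assign, Program.addr, NExp.Fits, NExp.val, hc.reg2, hc.reg1,
        h3, h4, true_and]
    refine ⟨⟨⟨⟨⟨by omega, by omega⟩, by omega⟩, by omega⟩, by omega⟩, ?_⟩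
    refine Prog.wp_mono (initCell_wp (I := I) hw (hF.stageCtx hc) (hF.done hd) hij hj
        (by simpa using h3)
      (by simpa using h4) (by simpa using h7) (by simp [idx]))
      fun s' ⟨T, f, e6, hT, hr, hle⟩ => ?_
    have h7' : s'.reg 7 = i := by
      rw [f.reg 7 (by simp) (by simp) (by simp) (by simp)]
      simpa using h7
    have hs' : SameArrays s' (s'.setReg 5 i) := ⟨rfl, rfl, fun x hx _ _ => by simp [hx]⟩
    rw [Prog.wp_assign, NExp.val, h7']
    refine ⟨trivial, ?_⟩
    refine ⟨⟨le_rfl, hij⟩, by simp, T, ⟨(hF.trans f).trans (hs'.frame _), by simpa using e6, hT,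
      hs'.records hr, hle⟩, fun d L R hv hdi => ?_⟩
    have := hv.of_lt.1
    omega
  refine (hinit.seq fun s₁ hs₁ => Runs.loop (SplitInv I st i j A s) (m := j) (t := 100) ?_ ?_
    (fun k s₂ hk hs₂ => Runs.of_wp_of_le (trySplit_wp hw hc hd hj h3 h4 hk hs₂) (by decide))
    hij hs₁).mono ?_ ?_
  · intro k s' h
    simp only [Test.Fits, NExp.Fits, NExp.val, h.2.1, true_and, and_true]
    have := h.1.2
    omega
  · intro k s' h
    have : s'.reg 4 = j := by
      obtain ⟨-, -, T, h, -⟩ := h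
      rw [h.frame.reg 4 (by simp) (by simp) (by simp) (by simp), h4]
    simp only [Test.Holds, NExp.val, this, h.2.1]
    omega
  · have : (Test.le (NExp.add (.var 5) (.lit 1)) (.var 4)).time = 5 := rfl
    rw [this]
    have : (j - i) * (100 + 5) ≤ n * (100 + 5) := Nat.mul_le_mul_right _ (by omega)
    omega
  · rintro s' ⟨-, -, T, h, hle⟩
    refine ⟨h.frame, T, h.valid, fun T' hT' => ?_, h.records⟩
    rcases h.le T' hT' with h | ⟨d, L, R, hv, hle'⟩
    · exact h
    · exact (hle d L R hv hv.of_lt.2.1).trans hle'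

end Cell

/-! ### Rows, stages and the choice of the next key -/

theorem Test.fits_le_var (w : ℕ) (s : State) (x y : ℕ) :
    (Test.le (.var x) (.var y)).Fits w s := ⟨trivial, trivial⟩

theorem CellOK.congr {I : Inst K n} {s s' : State} {p i j : ℕ} {A : Finset (Fin n)}
    (h : CellOK I s p A i j) (ha : s'.arr 0 = s.arr 0 ∧ s'.arr 1 = s.arr 1 ∧ s'.arr 2 = s.arr 2 ∧
      s'.arr 3 = s.arr 3) (hr : s'.rarr = s.rarr) : CellOK I s' p A i j := by
  obtain ⟨T, h1, h2, h3, h4, h5⟩ := h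
  refine ⟨T, h1, h2, ?_, by rw [hr, h4], by rw [hr, h5]⟩
  clear h1 h2 h4 h5
  induction T generalizing p with
  | leaf l => cases l <;> simpa only [State.RepBelow, ha] using h3
  | node c b Y N ihY ihN =>
    simp only [State.RepBelow, ha] at h3 ⊢
    exact ⟨h3.1, h3.2.1, h3.2.2.1, h3.2.2.2.1, ihY h3.2.2.2.2.1, ihN h3.2.2.2.2.2⟩

theorem Base.setReg {I : Inst K n} {s : State} (h : Base I s) {x : ℕ} (hx : 1 < x) (v : ℕ) :
    Base I (s.setReg x v) where
  reg0 := by simp [show 0 ≠ x by omega, h.reg0]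
  reg1 := by simp [show 1 ≠ x by omega, h.reg1]
  key_weight := h.key_weight
  gap_weight := h.gap_weight
  key_leaf := h.key_leaf

theorem CellOK.setReg {I : Inst K n} {s : State} {p i j : ℕ} {A : Finset (Fin n)}
    (h : CellOK I s p A i j) (x v : ℕ) : CellOK I (s.setReg x v) p A i j :=
  h.congr ⟨rfl, rfl, rfl, rfl⟩ rfl

theorem StageCtx.setReg {I : Inst K n} {st : ℕ} {A : Finset (Fin n)} {s : State}
    (h : StageCtx I st A s) {x : ℕ} (hx : 2 < x) (hx8 : x ≠ 8) (v : ℕ) :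
    StageCtx I st A (s.setReg x v) where
  toBase := h.toBase.setReg (by omega) v
  le := h.le
  reg2 := by simp [show 2 ≠ x by omega, h.reg2]
  mark := h.mark
  last := h.last.imp_right fun ⟨h0, k, h1, h2, h3, h4⟩ =>
    ⟨h0, k, by simp [hx8.symm, h1], h2, h3, fun i j hi hj => (h4 i j hi hj).setReg x v⟩

/-- The invariant of the loop over the rows of a stage. -/
def RowInv (I : Inst K n) (st : ℕ) (A : Finset (Fin n)) (u : ℕ) (s : State) : Prop :=
  StageCtx I st A s ∧ s.reg 3 = u ∧
    ∀ i j, i ≤ j → j ≤ n → n < u + i → CellOK I s (idx n st i j) A i j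

theorem row_runs {w : ℕ} (hw : 4 * (n + 1) ^ 3 ≤ w) {I : Inst K n} {st : ℕ} {A : Finset (Fin n)}
    {u : ℕ} (hu : u < n + 1) {s : State} (hs : RowInv I st A u s) :
    Runs w Program.row s (320 * (n + 1) ^ 2) (RowInv I st A (u + 1)) := by
  obtain ⟨hc, h3, hd⟩ := hs
  have b := word_bounds hw
  let J : ℕ → State → Prop := fun j s => StageCtx I st A s ∧ Done I st A (n - u) j s ∧
    s.reg 3 = u ∧ s.reg 4 = j ∧ s.reg 7 = n - u ∧ n - u ≤ j ∧ j ≤ n + 1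
  have hstart : Runs w (.seq (.assign 7 (.sub (.var 0) (.var 3))) (.assign 4 (.var 7))) s 6
      (J (n - u)) := by
    refine Runs.of_wp_of_le ?_ (by decide)
    simp only [Prog.wp_seq, Prog.wp_assign, NExp.Fits, NExp.val, hc.reg0, h3, true_and, and_true,
      State.setReg_reg, if_true]
    refine ⟨(hc.setReg (by simp) (by simp) _).setReg (by simp) (by simp) _, ?_, by simpa using h3,
      by simp, by simp, le_rfl, by omega⟩
    intro i j hi hj hlt
    exact ((hd i j hi hj (by omega)).setReg _ _).setReg _ _
  have hloop : ∀ s', J (n - u) s' → Runs w (.loop (.le (.var 4) (.var 0))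
      (.seq Program.cell (.assign 4 (.add (.var 4) (.lit 1))))) s'
      ((n + 1 - (n - u)) * (300 * (n + 1) + 4 + 3) + 3) (J (n + 1)) := by
    intro s' hs'
    refine Runs.loop J (m := n + 1) (fun _ _ _ => Test.fits_le_var _ _ _ _) ?_ ?_ (by omega) hs'
    · rintro j s₁ ⟨hc, -, -, h4, -⟩
      simp only [Test.Holds, NExp.val, h4, hc.reg0]
      omega
    · rintro j s₁ hj ⟨hc, hd, h3, h4, h7, hij, -⟩
      refine (cell_runs hw hc hd hij (by omega) (by omega) h4 h7).seq fun s₂ ⟨f, hok⟩ =>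
        Runs.of_wp_of_le ?_ (by decide)
      have h4' : s₂.reg 4 = j := by rw [f.reg 4 (by simp) (by simp) (by simp) (by simp), h4]
      simp only [Prog.wp_assign, NExp.Fits, NExp.val, h4', true_and]
      refine ⟨by omega, (f.stageCtx hc).setReg (by simp) (by simp) _, ?_, ?_, by simp, ?_, by omega,
        by omega⟩
      · intro i' j' hi' hj' hlt
        refine CellOK.setReg ?_ _ _
        by_cases h : i' = n - u ∧ j' = j
        · rw [h.1, h.2]; exact hok
        · exact f.done hd i' j' hi' hj' (by omega)
      · simp [f.reg 3, h3]
      · simp [f.reg 7, h7]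
  refine ((hstart.seq fun s₁ hs₁ => (hloop s₁ hs₁).seq fun s₂ hs₂ => Runs.of_wp_of_le (t := 4)
    (Q := RowInv I st A (u + 1)) ?_ (by decide))).mono ?_ fun _ => id
  · obtain ⟨hc, hd, h3, -⟩ := hs₂
    simp only [Prog.wp_assign, NExp.Fits, NExp.val, h3, true_and]
    refine ⟨by omega, hc.setReg (by simp) (by simp) _, by simp, fun i j hi hj hlt => ?_⟩
    exact (hd i j hi hj (by omega)).setReg _ _
  · have : (n + 1 - (n - u)) * (300 * (n + 1) + 4 + 3) ≤ (n + 1) * (300 * (n + 1) + 4 + 3) :=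
      Nat.mul_le_mul_right _ (by omega)
    nlinarith

/-- The invariant of the search for the key to be added to `A`. -/
def SelectInv (I : Inst K n) (A : Finset (Fin n)) (s : State) (k : ℕ) (s' : State) : Prop :=
  s'.arr = s.arr ∧ s'.rarr = s.rarr ∧ (∀ x, x ≠ 8 → x ≠ 9 → s'.reg x = s.reg x) ∧
    k ≤ n ∧ s'.reg 9 = k ∧
    ((s'.reg 8 = n ∧ ∀ g : Fin n, g.val < k → g ∈ A) ∨ ∃ h : Fin n, s'.reg 8 = h.val ∧ h ∉ A ∧
      ∀ g : Fin n, g.val < k → g ∉ A → I.β h ≤ I.β g)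

theorem considerKey_wp {w : ℕ} (hw : n + 1 ≤ w) {I : Inst K n} {A : Finset (Fin n)} {s s₁ : State}
    (hb : Base I s) (hm : ∀ b : Fin n, s.arr 4 b.val = 0 ↔ b ∉ A) {k : ℕ} (hk : k < n)
    (hs : SelectInv I A s k s₁) : Program.considerKey.wp w (SelectInv I A s (k + 1)) s₁ := by
  obtain ⟨ha, hr, hreg, -, h9, h8⟩ := hs
  have h0 : s₁.reg 0 = n := by rw [hreg 0 (by simp) (by simp), hb.reg0]
  have hstep : ∀ s' : State, s'.arr = s.arr → s'.rarr = s.rarr →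
      (∀ x, x ≠ 8 → x ≠ 9 → s'.reg x = s.reg x) →
      s'.reg 9 = k →
      ((s'.reg 8 = n ∧ ∀ g : Fin n, g.val < k + 1 → g ∈ A) ∨ ∃ h : Fin n, s'.reg 8 = h.val ∧ h ∉ A ∧
        ∀ g : Fin n, g.val < k + 1 → g ∉ A → I.β h ≤ I.β g) →
      (1 ≤ w ∧ s'.reg 9 + 1 ≤ w) ∧
        SelectInv I A s (k + 1) (s'.setReg 9 (s'.reg 9 + 1)) := by
    intro s' h1 h2 h3 h4 h5
    rw [h4]
    exact ⟨by omega, h1, h2, fun x hx hx' => by simp [hx', h3 x hx hx'], by omega, by simp,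
      by simpa using h5⟩
  have hkm : s.arr 4 (s₁.reg 9) = 0 ↔ (⟨k, hk⟩ : Fin n) ∉ A := h9 ▸ hm ⟨k, hk⟩
  have hlt : ∀ g : Fin n, g.val < k + 1 → g = ⟨k, hk⟩ ∨ g.val < k := fun g hg => by
    rw [Fin.ext_iff]
    simp only
    omega
  simp only [Program.considerKey, Prog.wp_seq, Prog.wp_ite, Prog.wp_assign, Prog.wp_skip, Test.Fits,
    Test.Holds, NExp.Fits, RExp.Fits, NExp.val, RExp.val, h0, ha, hr, true_and]
  have hset : ∀ v, (s₁.setReg 8 v).arr = s.arr ∧ (s₁.setReg 8 v).rarr = s.rarr ∧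
      (∀ x, x ≠ 8 → x ≠ 9 → (s₁.setReg 8 v).reg x = s.reg x) ∧ (s₁.setReg 8 v).reg 9 = k := fun v =>
    ⟨ha, hr, fun x hx hx' => by simp [hx, hreg x hx hx'], by simpa using h9⟩
  refine ⟨by omega, fun hk0 => ⟨fun h8n => ?_, fun h8n => ⟨fun hle => ?_, fun hle => ?_⟩⟩,
    fun hk0 => ?_⟩
  · obtain ⟨e1, e2, e3, e4⟩ := hset (s₁.reg 9)
    refine hstep _ e1 e2 e3 e4 (.inr ⟨⟨k, hk⟩, by simp [h9], hkm.1 hk0, fun g hg hgA => ?_⟩)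
    rcases hlt g hg with rfl | hg
    · exact le_rfl
    · rcases h8 with ⟨-, h8⟩ | ⟨h, h8, -⟩
      · exact absurd (h8 g hg) hgA
      · omega
  · obtain ⟨e1, e2, e3, e4⟩ := hset (s₁.reg 9)
    refine hstep _ e1 e2 e3 e4 (.inr ⟨⟨k, hk⟩, by simp [h9], hkm.1 hk0, fun g hg hgA => ?_⟩)
    rcases hlt g hg with rfl | hg
    · exact le_rfl
    · rcases h8 with ⟨h8, -⟩ | ⟨h, h8, -, hmin⟩
      · omega
      · rw [h9, h8, hb.key_weight h,
          show s.rarr 0 k = I.β ⟨k, hk⟩ from hb.key_weight ⟨k, hk⟩] at hle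
        exact hle.trans (hmin g hg hgA)
  · rcases h8 with ⟨h8, -⟩ | ⟨h, h8, hhA, hmin⟩
    · omega
    · refine hstep _ ha hr hreg h9 (.inr ⟨h, h8, hhA, fun g hg hgA => ?_⟩)
      rcases hlt g hg with rfl | hg
      · rw [h9, h8, hb.key_weight h,
          show s.rarr 0 k = I.β ⟨k, hk⟩ from hb.key_weight ⟨k, hk⟩] at hle
        exact (not_le.1 hle).le
      · exact hmin g hg hgA
  · have hkA : (⟨k, hk⟩ : Fin n) ∈ A := by
      by_contra h
      exact hk0 (hkm.2 h)
    refine hstep _ ha hr hreg h9 (h8.imp (fun ⟨h, h'⟩ => ⟨h, fun g hg => ?_⟩)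
      fun ⟨h, h', hhA, hmin⟩ => ⟨h, h', hhA, fun g hg hgA => ?_⟩)
    · rcases hlt g hg with rfl | hg
      · exact hkA
      · exact h' g hg
    · rcases hlt g hg with rfl | hg
      · exact absurd hkA hgA
      · exact hmin g hg hgA

/-- The state at the beginning of stage `st`, when the keys in `A` have been added. -/
structure StageInv (I : Inst K n) (st : ℕ) (A : Finset (Fin n)) (s : State) : Prop
    extends Base I s where
  le : st ≤ n + 1
  reg2 : s.reg 2 = st
  mark : ∀ b : Fin n, s.arr 4 b.val = 0 ↔ b ∉ A
  -- Stage `0` adds no key, so `A` is empty at the start of stages `0` and `1`; truncated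
  -- subtraction covers both.
  card : A.card = st - 1
  light : ∀ f ∈ A, ∀ g ∉ A, I.β f ≤ I.β g
  cells : 0 < st → ∀ i j, i ≤ j → j ≤ n → CellOK I s (idx n (st - 1) i j) A i j

/-- By `light`, a key outside `A` weighs at least as much as every key in `A`. Hence the lightest
one outside becomes the heaviest of the enlarged set, as `Valid.exchange` requires. -/
theorem addKey_runs {w : ℕ} (hw : 4 * (n + 1) ^ 3 ≤ w) {I : Inst K n} {st : ℕ} {A : Finset (Fin n)}
    {s : State} (hs : StageInv I st A s) (hst : 0 < st) (hstn : st ≤ n) :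
    Runs w Program.addKey s (40 * (n + 1)) (fun s' => ∃ h ∉ A, StageCtx I st (insert h A) s' ∧
      ∀ f ∈ insert h A, ∀ g ∉ insert h A, I.β f ≤ I.β g) := by
  obtain ⟨b1, b2, b3⟩ := word_bounds hw
  have hstart : Runs w (.seq (.assign 8 (.var 0)) (.assign 9 (.lit 0))) s 4
      (SelectInv I A s 0) := by
    refine Runs.of_wp_of_le ?_ (by decide)
    simp only [Prog.wp_seq, Prog.wp_assign, NExp.Fits, NExp.val, hs.reg0, true_and]
    exact ⟨by omega, rfl, rfl, fun x hx hx' => by simp [hx, hx'], by omega, by simp,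
      .inl ⟨by simp, by simp⟩⟩
  refine ((hstart.seq fun s₁ hs₁ => (Runs.loop (SelectInv I A s) (m := n) (t := 20) ?_ ?_
    (fun k s₂ hk hs₂ => Runs.of_wp_of_le (considerKey_wp b1 hs.toBase hs.mark hk hs₂) (by decide))
    (Nat.zero_le n) hs₁).seq fun s₂ hs₂ => Runs.of_wp_of_le (t := 3) (Q := fun s' => ∃ h ∉ A,
      StageCtx I st (insert h A) s' ∧
      ∀ f ∈ insert h A, ∀ g ∉ insert h A, I.β f ≤ I.β g) ?_ (by decide))).mono ?_ fun _ => id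
  · rintro k s' ⟨-, -, -, hk, h9, -⟩
    simp only [Test.Fits, NExp.Fits, NExp.val, h9, true_and, and_true]
    omega
  · rintro k s' ⟨-, -, hreg, hk, h9, -⟩
    simp only [Test.Holds, NExp.val, h9, hreg 0 (by simp) (by simp), hs.reg0]
    omega
  · obtain ⟨ha, hr, hreg, -, -, h8⟩ := hs₂
    obtain ⟨h, h8, hhA, hmin⟩ : ∃ h : Fin n, s₂.reg 8 = h.val ∧ h ∉ A ∧
        ∀ g : Fin n, g.val < n → g ∉ A → I.β h ≤ I.β g := by
      -- A scan without a candidate would mean that all `n` keys are in `A`, which has only `st - 1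
      -- < n` elements.
      refine h8.resolve_left fun ⟨_, hall⟩ => ?_
      have : A = Finset.univ := Finset.eq_univ_iff_forall.2 fun g => hall g g.isLt
      have hcard := hs.card
      rw [this, Finset.card_univ, Fintype.card_fin] at hcard
      omega
    simp only [Prog.wp, NExp.Fits, NExp.val, h8, true_and]
    refine ⟨by omega, h, hhA, ?_, ?_⟩
    · refine ⟨⟨?_, ?_, ?_, ?_, ?_⟩, hstn, ?_, ?_, .inr ⟨hst, h, ?_, by simp, ?_, ?_⟩⟩
      · simp [hreg 0, hs.reg0]
      · simp [hreg 1, hs.reg1]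
      · simp [hr, hs.key_weight]
      · simp [hr, hs.gap_weight]
      · simpa [ha] using hs.key_leaf
      · simp [hreg 2, hs.reg2]
      · intro b
        by_cases hbh : b = h
        · subst hbh; simp
        · simp [ha, hbh, hs.mark, ← Fin.ext_iff]
      · simp [h8]
      · intro f hf
        rcases Finset.mem_insert.1 hf with rfl | hf
        · exact le_rfl
        · exact hs.light f hf h hhA
      · intro i j hi hj
        rw [Finset.erase_insert hhA]
        refine (hs.cells hst i j hi hj).congr ?_ (by simp [hr])
        refine ⟨?_, ?_, ?_, ?_⟩ <;> funext k <;> simp [ha]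
    · intro f hf g hg
      rw [Finset.mem_insert, not_or] at hg
      rcases Finset.mem_insert.1 hf with rfl | hf
      · exact hmin g g.isLt hg.2
      · exact hs.light f hf g hg.2
  · have : (Test.le (NExp.add (.var 9) (.lit 1)) (.var 0)).time = 5 := rfl
    rw [this]
    omega

theorem stage_runs {w : ℕ} (hw : 4 * (n + 1) ^ 3 ≤ w) {I : Inst K n} {st : ℕ} (hst : st < n + 1)
    {s : State} (hs : ∃ A, StageInv I st A s) :
    Runs w Program.stage s (400 * (n + 1) ^ 3) (fun s' => ∃ A, StageInv I (st + 1) A s') := by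
  obtain ⟨A, hs⟩ := hs
  have b := word_bounds hw
  have hadd : Runs w (.ite (.eq (.var 2) (.lit 0)) .skip Program.addKey) s (3 + 40 * (n + 1))
      (fun s' => ∃ A, StageCtx I st A s' ∧ A.card = st ∧ ∀ f ∈ A, ∀ g ∉ A, I.β f ≤ I.β g) := by
    refine Runs.ite ⟨trivial, by simp [NExp.Fits]⟩ (fun h => ?_) fun h => ?_ <;>
      simp only [Test.Holds, NExp.val, hs.reg2] at h
    · subst h
      have hA : A = ∅ := Finset.card_eq_zero.1 hs.card
      refine Runs.of_wp_of_le (Prog.wp_skip _ _ _ ▸ ⟨A, ⟨hs.toBase, Nat.zero_le n, hs.reg2, hs.mark,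
        .inl ⟨rfl, hA⟩⟩, hs.card, hs.light⟩) ?_
      simp only [Prog.stepBound]
      omega
    · refine (addKey_runs hw hs (by omega) (by omega)).mono le_rfl
        fun s' ⟨h, hA, hc, hl⟩ => ⟨insert h A, hc, ?_, hl⟩
      rw [Finset.card_insert_of_notMem hA, hs.card]
      omega
  refine (hadd.seq fun s₁ ⟨A, hc, hcard, hl⟩ =>
    (Runs.of_wp_of_le (t := 2) (Q := RowInv I st A 0) ?_ (by decide)).seq fun s₂ hs₂ =>
    (Runs.loop (RowInv I st A) (m := n + 1) (t := 320 * (n + 1) ^ 2)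
      (fun _ _ _ => Test.fits_le_var _ _ _ _) ?_ (fun u s₃ hu hs₃ => row_runs hw hu hs₃)
          (Nat.zero_le _)
      hs₂).seq fun s₃ hs₃ => Runs.of_wp_of_le (t := 4)
      (Q := fun s' => ∃ A, StageInv I (st + 1) A s') ?_ (by decide)).mono ?_ fun _ => id
  · simp only [Prog.wp_assign, NExp.Fits, NExp.val]
    exact ⟨by omega, hc.setReg (by simp) (by simp) _, by simp, fun i j hi hj hlt => by omega⟩
  · rintro u s₃ ⟨hc, h3, -⟩
    simp only [Test.Holds, NExp.val, h3, hc.reg0]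
    omega
  · obtain ⟨hc, -, hcells⟩ := hs₃
    simp only [Prog.wp_assign, NExp.Fits, NExp.val, hc.reg2, true_and]
    exact ⟨by omega, A, hc.toBase.setReg (by simp) _, by omega, by simp, hc.mark, hcard, hl,
      fun _ i j hi hj => (hcells i j hi hj (by omega)).setReg _ _⟩
  · have : (Test.le (NExp.var 3) (.var 0)).time = 3 := rfl
    rw [this, Nat.sub_zero]
    have h1 : (n + 1) ^ 3 = (n + 1) * (n + 1) ^ 2 := by ring
    have h2 : (n + 1) * 1 ≤ (n + 1) * (n + 1) ^ 2 :=
      Nat.mul_le_mul_left _ (Nat.one_le_pow _ _ (by omega))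
    rw [h1]
    linarith [mul_add (n + 1) (320 * (n + 1) ^ 2) 3, mul_left_comm (n + 1) 320 ((n + 1) ^ 2)]

/-! ### The whole run and its cost -/

theorem Inst.main_runs {w : ℕ} (hw : 4 * (n + 1) ^ 3 ≤ w) (I : Inst K n) :
    Runs w Program.main I.input (450 * (n + 1) ^ 4) (fun s => ∃ T, I.IsOptimal T ∧
      s.Represents (s.reg 0) T ∧ s.rreg 0 = I.cost T) := by
  obtain ⟨b1, b2, b3⟩ := word_bounds hw
  -- the invariant of the loop that writes the leaves of the keys
  let J : ℕ → State → Prop := fun k s => k ≤ n ∧ s.reg 0 = n ∧ s.reg 1 = n + 1 ∧ s.reg 2 = 0 ∧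
    s.reg 9 = k ∧ s.rarr = I.input.rarr ∧ (∀ i, s.arr 0 i = 0) ∧ (∀ i < k, s.arr 1 i = i) ∧
    ∀ i, s.arr 4 i = 0
  refine ((Runs.of_wp_of_le (t := 4) (Q := J 0) ?_ (by decide)).seq fun s₁ hs₁ =>
    (Runs.loop J (m := n) (t := 7) ?_ ?_ ?_ (Nat.zero_le n) hs₁).seq fun s₂ hs₂ =>
    (Runs.loop (fun st s => ∃ A, StageInv I st A s) (m := n + 1) (t := 400 * (n + 1) ^ 3)
      (fun _ _ _ => Test.fits_le_var _ _ _ _) ?_ (fun st s₃ hst hs₃ => stage_runs hw hst hs₃)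
      (Nat.zero_le _) ⟨∅, ?_⟩).seq fun s₃ hs₃ => Runs.of_wp_of_le (t := 20)
      (Q := fun s => ∃ T, I.IsOptimal T ∧ s.Represents (s.reg 0) T ∧ s.rreg 0 = I.cost T)
      ?_ (by decide)).mono ?_ fun _ => id
  · simp only [Prog.wp_assign, NExp.Fits, NExp.val, true_and]
    refine ⟨⟨by omega, by simpa [Inst.input] using b1⟩, ?_⟩
    simp [J, Inst.input, State.setReg]
  · rintro k s ⟨hk, -, -, -, h9, -⟩
    simp only [Test.Fits, NExp.Fits, NExp.val, h9, true_and, and_true]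
    omega
  · rintro k s ⟨hk, h0, -, -, h9, -⟩
    simp only [Test.Holds, NExp.val, h9, h0]
    omega
  · rintro k s hk ⟨-, h0, h1, h2, h9, hr, ha0, ha1, ha4⟩
    refine Runs.of_wp_of_le ?_ (by decide)
    simp only [Prog.wp, NExp.Fits, NExp.val, h9, true_and, State.setArr_reg]
    refine ⟨by omega, hk, by simpa using h0, by simpa using h1, by simpa using h2, by simp, hr,
      by simpa using ha0, fun i hi => ?_, by simpa using ha4⟩
    by_cases hik : i = k
    · simp [hik]
    · simpa [hik] using ha1 i (by omega)
  · rintro st s ⟨A, hs⟩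
    simp only [Test.Holds, NExp.val, hs.reg0, hs.reg2]
    omega
  · obtain ⟨-, h0, h1, h2, -, hr, ha0, ha1, ha4⟩ := hs₂
    refine ⟨⟨h0, h1, fun b => ?_, fun a => ?_, fun k hk => ⟨ha0 k, ha1 k hk⟩⟩, by omega, h2,
      by simp [ha4], rfl, by simp, by simp⟩
    · simp [hr, Inst.input]
    · simp only [hr, Inst.input, one_ne_zero, if_false, if_true, a.isLt, dif_pos]
  · obtain ⟨A, hs⟩ := hs₃
    have bb := addr_bounds (u := n) (j := n) hw le_rfl le_rfl le_rfl
    have hA : A = Finset.univ := by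
      rw [← Finset.card_eq_iff_eq_univ, Fintype.card_fin, hs.card]
      omega
    obtain ⟨T, hT, hTo, hrep, hcost, -⟩ := hs.cells (by omega) 0 n (Nat.zero_le n) le_rfl
    rw [hA] at hT hTo
    simp only [Nat.add_sub_cancel, idx, Nat.sub_zero] at hrep hcost
    simp only [Prog.wp, Program.addr, NExp.Fits, NExp.val, RExp.Fits, RExp.val, hs.reg0, hs.reg1,
      true_and, State.setReg_reg, if_true]
    refine ⟨by omega, T, ⟨(I.isSearchTree_iff T).2 hT, fun T' hT' =>
      hTo T' ((I.isSearchTree_iff T').1 hT')⟩, ?_, ?_⟩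
    · simp only [State.setRreg_reg, State.setReg_reg, if_true]
      refine State.RepBelow.represents (hrep.congr fun B k _ => ?_)
      rfl
    · simpa using hcost
  · have e1 : (Test.le (NExp.add (.var 9) (.lit 1)) (.var 0)).time = 5 := rfl
    have e2 : (Test.le (NExp.var 2) (.var 0)).time = 3 := rfl
    rw [e1, e2, Nat.sub_zero, Nat.sub_zero]
    have h1 : (n + 1) ^ 4 = (n + 1) * (n + 1) ^ 3 := by ring
    have h2 : (n + 1) * 1 ≤ (n + 1) * (n + 1) ^ 3 :=
      Nat.mul_le_mul_left _ (Nat.one_le_pow _ _ (by omega))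
    rw [h1]
    linarith [mul_add (n + 1) (400 * (n + 1) ^ 3) 3, mul_left_comm (n + 1) 400 ((n + 1) ^ 3)]

theorem add_one_pow_four_le (n : ℕ) : (n + 1) ^ 4 ≤ 16 * (n ^ 4 + 1) := by
  rcases Nat.eq_zero_or_pos n with rfl | hn
  · simp
  · calc (n + 1) ^ 4 ≤ (2 * n) ^ 4 := Nat.pow_le_pow_left (by omega) 4
      _ = 16 * n ^ 4 := by ring
      _ ≤ 16 * (n ^ 4 + 1) := by omega

end TwoWay

end

theorem corollary1 :
    ∃ (P : TwoWay.Prog) (C D : ℕ),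
      ∀ (K : Type*) [LinearOrder K] (n : ℕ) (I : TwoWay.Inst K n),
        ∃ (t : ℕ) (s : TwoWay.State) (T : TwoWay.Tree n),
          TwoWay.Exec (C * (n + 1) ^ D) P I.input t s ∧
          t ≤ C * (n ^ 4 + 1) ∧
          I.IsOptimal T ∧
          s.Represents (s.reg 0) T ∧
          s.rreg 0 = I.cost T := by
  -- Here `7200 = 450 * 16` comes from `450 * (n + 1) ^ 4` and `(n + 1) ^ 4 ≤ 16 * (n ^ 4 + 1)`. As
  -- a factor in the word bound it is generous, since `4 * (n + 1) ^ 3` suffices.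
  refine ⟨TwoWay.Program.main, 7200, 3, fun K _ n I => ?_⟩
  obtain ⟨t, s, he, ht, T, hT⟩ := I.main_runs (w := 7200 * (n + 1) ^ 3)
    (Nat.mul_le_mul_right _ (by norm_num))
  refine ⟨t, s, T, he, ?_, hT⟩
  have := TwoWay.add_one_pow_four_le n
  omega
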